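/- Equip $\mathbb{R}^{n+m}=\mathbb{R}^n\times\mathbb{R}^m$ with the Euclidean norm $|\cdot|$ and distance $d$. For $\varphi:\mathbb{R}^{n+m}\to\mathbb{R}$ put $\mathbf f=(\varphi_x,-\varphi_y)$; for a convex set $K$ and $\mathbf z\in K$ let $N_K(\mathbf z)=\{v: v^T(w-\mathbf z)\le 0\ \forall w\in K\}$ be the normal cone, and let $\mathbf P_A$ denote the projection onto a non-empty closed convex set $A$. A function is concave-convex on a convex set $C\subseteq\mathbb{R}^{n+m}$ if on the slices of $C$ it is concave in $x$ for each fixed $y$ and convex in $y$ for each fixed $x$. A point $\bar{\mathbf z}=(\bar x,\bar y)\in K$ is a $K$-restricted saddle point of $\varphi$ if $\varphi(x,\bar y)\le\varphi(\bar x,\bar y)\le\varphi(\bar x,y)$ whenever $(x,\bar y),(\bar x,y)\in K$, and $\mathbf f(\bar{\mathbf z})\in N_K(\bar{\mathbf z})$ (if $K$ is a product of convex sets $X\subseteq\mathbb{R}^n$, $Y\subseteq\mathbb{R}^m$, the second condition follows from the first; if $\varphi$ is concave-convex on $K$, the first follows from the second). A face of $K$ is a convex subset $F\subseteq K$ that contains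 every segment in $K$ whose relative interior meets $F$; the minimal face containing a set is the intersection of all faces containing it. The subgradient method on $K$ consists of the Carathéodory solutions $\mathbf z:[0,\infty)\to K$ (locally absolutely continuous, equation satisfied for almost all $t$) of $$\dot{\mathbf z}=\mathbf f(\mathbf z)-\mathbf P_{N_K(\mathbf z)}(\mathbf f(\mathbf z)),$$ and its $\omega$-limit set is $\Omega=\bigcup_{\mathbf z}\bigcap_{t\ge0}\overline{\mathbf z([t,\infty))}$, the union being over all these solutions. **Theorem.** Let $K\subseteq\mathbb{R}^{n+m}$ be closed and convex. Let $\varphi:\mathbb{R}^{n+m}\to\mathbb{R}$ be $C^2$ and concave-convex on a convex set $C\supseteq K$ whose affine hull is a product of an affine subspace of $\mathbb{R}^n$ and an affine subspace of $\mathbb{R}^m$ (for example $C=K$ if $K$ has interior points or is a product $X\times Y$; or $C=\mathbb{R}^{n+m}$). Assume that $\varphi$ has a $K$-restricted saddle point. Then $\Omega$ is convex, and there is a flow $\psi:\mathbb{R}\times\Omega\to\Omega$ of isometries of $(\Omega,d)$ which for $t\ge0$ is the subgradient method on $K$: for each $p\in\Omega$ the map $t\mapsto\psi(t,p)$, $t\ge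 0$, is a solution of the subgradient method on $K$, and the only one starting at $p$. Moreover: (i) Let $V$ be the affine span of the minimal face of $K$ containing all $K$-restricted saddle points. Every trajectory $\mathbf z(t)=\psi(t,p)$, $p\in\Omega$, $t\in\mathbb{R}$, lies in $V$ and solves the subgradient method on $V$, that is, for all $t\in\mathbb{R}$, $$\dot{\mathbf z}=\mathbf f(\mathbf z)-\mathbf P_{N_V}(\mathbf f(\mathbf z)),$$ where $N_V$ is the normal cone to $V$ (the same at all points of $V$). (ii) Call the $C$-restricted saddle points of $\varphi$ its saddle points (for $C=\mathbb{R}^{n+m}$ these are the usual saddle points). Let $\mathcal S$ be the set of solutions $\mathbf z:\mathbb{R}\to\mathbb{R}^{n+m}$ of the gradient method $\dot x=\varphi_x$, $\dot y=-\varphi_y$ whose distance from each saddle point of $\varphi$ is constant in time. If $\varphi$ has a saddle point in the interior of $K$, then the trajectories of $\psi$ are exactly the $\mathbf z\in\mathcal S$ with $\mathbf z(\mathbb{R})\subseteq K$, and $$\Omega=\{\mathbf z(t):\ t\in\mathbb{R},\ \mathbf z\in\mathcal S,\ \mathbf z(\mathbb{R})\subseteq K\}.$$ -/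

import Mathlib

open Set Filter Topology MeasureTheory

namespace SubgradientFaces

/-- The Euclidean space `ℝⁿ⁺ᵐ`, with coordinates indexed by the disjoint union of the indices of
the coordinates of `x ∈ ℝⁿ` and of `y ∈ ℝᵐ`. -/
abbrev Pt (n m : ℕ) : Type := EuclideanSpace ℝ (Fin n ⊕ Fin m)

/-- The point `(x, y)` of `ℝⁿ⁺ᵐ`. -/
def pt {n m : ℕ} (x : EuclideanSpace ℝ (Fin n)) (y : EuclideanSpace ℝ (Fin m)) : Pt n m :=
  WithLp.toLp 2 (Sum.elim x y)

/-- The component `x` of `z = (x, y)`. -/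
def xPart {n m : ℕ} (z : Pt n m) : EuclideanSpace ℝ (Fin n) :=
  WithLp.toLp 2 (fun i => z (Sum.inl i))

/-- The component `y` of `z = (x, y)`. -/
def yPart {n m : ℕ} (z : Pt n m) : EuclideanSpace ℝ (Fin m) :=
  WithLp.toLp 2 (fun j => z (Sum.inr j))

/-- `φ` is concave-convex on `C`: concave in `x` for fixed `y`, and convex in `y` for fixed `x`,
on the slices of `C`. -/
def ConcaveConvexOn {n m : ℕ} (C : Set (Pt n m)) (φ : Pt n m → ℝ) : Prop :=
  (∀ y, ConcaveOn ℝ {x | pt x y ∈ C} (fun x => φ (pt x y))) ∧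
    ∀ x, ConvexOn ℝ {y | pt x y ∈ C} (fun y => φ (pt x y))

/-- The affine hull of `C` is the product of an affine subspace of `ℝⁿ` and one of `ℝᵐ`. -/
def HasProductSpan {n m : ℕ} (C : Set (Pt n m)) : Prop :=
  ∃ (A : AffineSubspace ℝ (EuclideanSpace ℝ (Fin n)))
    (B : AffineSubspace ℝ (EuclideanSpace ℝ (Fin m))),
    ∀ z : Pt n m, z ∈ affineSpan ℝ C ↔ xPart z ∈ A ∧ yPart z ∈ B

/-- The vector field `f = (φ_x, -φ_y)` of the gradient method. -/
noncomputable def gradField {n m : ℕ} (φ : Pt n m → ℝ) (z : Pt n m) : Pt n m :=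
  pt (xPart (gradient φ z)) (-yPart (gradient φ z))

section Convex

variable {E : Type*} [NormedAddCommGroup E] [InnerProductSpace ℝ E]

/-- The normal cone `N_K(z)` to `K` through a point `z` of `K`. -/
def normalCone (K : Set E) (z : E) : Set E :=
  {v | ∀ w ∈ K, inner ℝ v (w - z) ≤ 0}

open Classical in
/-- The metric projection `P_C(v)`: the point of `C` nearest to `v`. It exists and is unique for
every non-empty closed convex `C` in a Euclidean space, in particular for every normal cone to `K`
through a point of `K`; the value `0` otherwise is never used. -/
noncomputable def proj (C : Set E) (v : E) : E :=
  if h : ∃ p ∈ C, ∀ q ∈ C, dist v p ≤ dist v q then h.choose else 0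

/-- `F` is a face of the convex set `K`: a convex subset of `K` such that every segment in `K`
whose relative interior meets `F` has its end points (hence all of its points) in `F`. -/
def IsFace (K F : Set E) : Prop :=
  Convex ℝ F ∧ IsExtreme ℝ K F

/-- The minimal face of `K` containing `A`. -/
def minimalFace (K A : Set E) : Set E :=
  ⋂₀ {F | IsFace K F ∧ A ⊆ F}

end Convex

/-- The saddle point inequalities `φ(x, ȳ) ≤ φ(x̄, ȳ) ≤ φ(x̄, y)` at the point `z = (x̄, ȳ)` of `K`,
for all `x`, `y` with `(x, ȳ) ∈ K` and `(x̄, y) ∈ K`. -/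
def SaddleInequalities {n m : ℕ} (φ : Pt n m → ℝ) (K : Set (Pt n m)) (z : Pt n m) : Prop :=
  z ∈ K ∧ (∀ x, pt x (yPart z) ∈ K → φ (pt x (yPart z)) ≤ φ z) ∧
    ∀ y, pt (xPart z) y ∈ K → φ z ≤ φ (pt (xPart z) y)

/-- `z` is a `K`-restricted saddle point of `φ`: the saddle point inequalities hold in `K`, and
`(φ_x, -φ_y)` lies in the normal cone to `K` through `z`. For `K = X ×ˢ Y` the second condition
follows from the first (`SaddleInequalities.isRestrictedSaddle`), and for `φ` concave-convex on
`K` the first follows from the second (`isRestrictedSaddle_iff_mem_normalCone`). For `K` the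
whole space this is the usual notion of a saddle point. -/
def IsRestrictedSaddle {n m : ℕ} (φ : Pt n m → ℝ) (K : Set (Pt n m)) (z : Pt n m) : Prop :=
  SaddleInequalities φ K z ∧ gradField φ z ∈ normalCone K z

/-- The (discontinuous) vector field `f(z) - P_{N_K(z)}(f(z))` of the subgradient method on `K`. -/
noncomputable def subgradField {n m : ℕ} (φ : Pt n m → ℝ) (K : Set (Pt n m)) (z : Pt n m) :
    Pt n m :=
  gradField φ z - proj (normalCone K z) (gradField φ z)

/-- `z : [0, ∞) → K` (extended arbitrarily to negative times) is a trajectory of the subgradient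
method on `K`, that is, a Carathéodory solution of `ż = f(z) - P_{N_K(z)}(f(z))` in `K`. -/
structure IsSubgradTrajectory {n m : ℕ} (φ : Pt n m → ℝ) (K : Set (Pt n m)) (z : ℝ → Pt n m) :
    Prop where
  mem : ∀ t, 0 ≤ t → z t ∈ K
  absolutelyContinuous : ∀ T, 0 ≤ T → AbsolutelyContinuousOnInterval z 0 T
  hasDerivAt : ∀ᵐ t ∂(volume : Measure ℝ), 0 < t → HasDerivAt z (subgradField φ K (z t)) t

/-- The `ω`-limit set of the subgradient method on `K`: the union over all trajectories `z` of
`⋂_{t ≥ 0} closure (z([t, ∞)))`. -/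
def omegaLimitSet {n m : ℕ} (φ : Pt n m → ℝ) (K : Set (Pt n m)) : Set (Pt n m) :=
  {p | ∃ z, IsSubgradTrajectory φ K z ∧ ∀ t, 0 ≤ t → p ∈ closure (z '' Ici t)}

/-- The affine span of the minimal face of `K` that contains all `K`-restricted saddle points. -/
noncomputable def saddleSpan {n m : ℕ} (φ : Pt n m → ℝ) (K : Set (Pt n m)) : AffineSubspace ℝ (Pt n m) :=
  affineSpan ℝ (minimalFace K {z | IsRestrictedSaddle φ K z})

/-- The set `𝒮` of the solutions `z : ℝ → ℝⁿ⁺ᵐ` of the gradient method `ẋ = φ_x`, `ẏ = -φ_y`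
that lie at a constant distance from every saddle point of the function `φ` on `C`. -/
def constDistSolutions {n m : ℕ} (φ : Pt n m → ℝ) (C : Set (Pt n m)) : Set (ℝ → Pt n m) :=
  {z | (∀ t, HasDerivAt z (gradField φ (z t)) t) ∧
    ∀ q, IsRestrictedSaddle φ C q → ∃ c : ℝ, ∀ t, dist (z t) q = c}


/-- A set with non-empty interior has a product as its affine hull. -/
theorem hasProductSpan_of_interior {n m : ℕ} {C : Set (Pt n m)} (h : (interior C).Nonempty) :
    HasProductSpan C :=
  ⟨⊤, ⊤, fun z => by simp [affineSpan_eq_top_of_nonempty_interior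
    (h.mono (interior_mono (subset_convexHull ℝ C)))]⟩

/-- A product has a product as its affine hull. -/
theorem hasProductSpan_of_prod {n m : ℕ} {X : Set (EuclideanSpace ℝ (Fin n))}
    {Y : Set (EuclideanSpace ℝ (Fin m))} :
    HasProductSpan {z : Pt n m | xPart z ∈ X ∧ yPart z ∈ Y} := by
  refine ⟨affineSpan ℝ X, affineSpan ℝ Y, fun z => ⟨fun hz => ?_, fun hz => ?_⟩⟩
  · refine affineSpan_induction hz (fun w hw => ⟨subset_affineSpan ℝ X hw.1,
      subset_affineSpan ℝ Y hw.2⟩) (fun c u v w hu hv hw => ⟨?_, ?_⟩)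
    · exact AffineSubspace.smul_vsub_vadd_mem _ c hu.1 hv.1 hw.1
    · exact AffineSubspace.smul_vsub_vadd_mem _ c hu.2 hv.2 hw.2
  · have key : ∀ x ∈ affineSpan ℝ X, ∀ y ∈ Y,
        pt x y ∈ affineSpan ℝ {z : Pt n m | xPart z ∈ X ∧ yPart z ∈ Y} := by
      intro x hx y hy
      refine affineSpan_induction hx (fun w hw => subset_affineSpan ℝ _ ⟨hw, hy⟩)
        (fun c u v w hu hv hw => ?_)
      have := AffineSubspace.smul_vsub_vadd_mem _ c hu hv hw
      convert! this using 1
      ext i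
      rcases i with i | i <;> simp [pt]
    have key2 : ∀ x ∈ affineSpan ℝ X, ∀ y ∈ affineSpan ℝ Y,
        pt x y ∈ affineSpan ℝ {z : Pt n m | xPart z ∈ X ∧ yPart z ∈ Y} := by
      intro x hx y hy
      refine affineSpan_induction hy (fun w hw => key x hx w hw) (fun c u v w hu hv hw => ?_)
      have := AffineSubspace.smul_vsub_vadd_mem _ c hu hv hw
      convert! this using 1
      ext i
      rcases i with i | i <;> simp [pt]
    have := key2 _ hz.1 _ hz.2
    convert! this using 1
    ext i
    rcases i with i | i <;> rfl

theorem inner_gradField {n m : ℕ} (φ : Pt n m → ℝ) (z w : Pt n m) :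
    inner ℝ (gradField φ z) (w - z) =
      fderiv ℝ φ z (pt (xPart w) (yPart z) - z) - fderiv ℝ φ z (pt (xPart z) (yPart w) - z) := by
  have h : ∀ v, fderiv ℝ φ z v = inner ℝ (gradient φ z) v := fun v => by
    simp [gradient]
  rw [h, h]
  simp only [PiLp.inner_apply, gradField, pt, xPart, yPart, Fintype.sum_sum_type]
  simp
  ring

theorem pt_parts {n m : ℕ} (z : Pt n m) : pt (xPart z) (yPart z) = z := by
  ext i
  rcases i with i | i <;> rfl

/-- The first order condition at the end point of a segment. -/
theorem fderiv_nonneg_of_segment {n m : ℕ} {φ : Pt n m → ℝ} {z w : Pt n m} {c : ℝ}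
    (hφ : DifferentiableAt ℝ φ z)
    (h : ∀ s ∈ Icc (0 : ℝ) 1, φ z + s * c ≤ φ (z + s • (w - z))) :
    c ≤ fderiv ℝ φ z (w - z) := by
  have h1 : HasDerivAt (fun s : ℝ => z + s • (w - z)) (w - z) 0 := by
    simpa using ((hasDerivAt_id (0 : ℝ)).smul_const (w - z)).const_add z
  have h2 : HasFDerivAt φ (fderiv ℝ φ z) (z + (0 : ℝ) • (w - z)) := by
    simpa using hφ.hasFDerivAt
  have h3 : HasDerivAt (fun s : ℝ => φ (z + s • (w - z)) - s * c)
      (fderiv ℝ φ z (w - z) - c) 0 := by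
    have h := (h2.comp_hasDerivAt 0 h1).sub ((hasDerivAt_id (0 : ℝ)).mul_const c)
    rw [one_mul] at h
    exact h
  have h4 : IsMinOn (fun s : ℝ => φ (z + s • (w - z)) - s * c) (Icc 0 1) 0 := by
    intro s hs
    have := h s hs
    simp only [mem_ofPred_eq, zero_smul, add_zero, zero_mul, sub_zero]
    linarith
  have h6 : (1 : ℝ) ∈ posTangentConeAt (Icc (0 : ℝ) 1) 0 := by
    have := sub_mem_posTangentConeAt_of_segment_subset (segment_eq_Icc (zero_le_one' ℝ)).subset
    simpa using this
  have h5 := h4.localize.hasFDerivWithinAt_nonneg h3.hasFDerivAt.hasFDerivWithinAt h6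
  rw [ContinuousLinearMap.toSpanSingleton_apply, one_smul] at h5
  linarith

theorem segment_x {n m : ℕ} (z w : Pt n m) (s : ℝ) :
    z + s • (pt (xPart w) (yPart z) - z) =
      pt ((1 - s) • xPart z + s • xPart w) (yPart z) := by
  ext i
  rcases i with i | i <;> simp [pt, xPart, yPart]
  ring

theorem segment_y {n m : ℕ} (z w : Pt n m) (s : ℝ) :
    z + s • (pt (xPart z) (yPart w) - z) =
      pt (xPart z) ((1 - s) • yPart z + s • yPart w) := by
  ext i
  rcases i with i | i <;> simp [pt, xPart, yPart]
  ring

/-- On a product, the saddle point inequalities say that `z` is a restricted saddle point. -/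
theorem SaddleInequalities.isRestrictedSaddle {n m : ℕ} {φ : Pt n m → ℝ}
    {X : Set (EuclideanSpace ℝ (Fin n))} {Y : Set (EuclideanSpace ℝ (Fin m))}
    (hX : Convex ℝ X) (hY : Convex ℝ Y) (hφ : Differentiable ℝ φ) {z : Pt n m}
    (h : SaddleInequalities φ {z : Pt n m | xPart z ∈ X ∧ yPart z ∈ Y} z) :
    IsRestrictedSaddle φ {z : Pt n m | xPart z ∈ X ∧ yPart z ∈ Y} z := by
  refine ⟨h, fun w hw => ?_⟩
  rw [inner_gradField]
  obtain ⟨hz, hx, hy⟩ := h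
  have h1 : (0 : ℝ) ≤ fderiv ℝ φ z (pt (xPart z) (yPart w) - z) := by
    refine fderiv_nonneg_of_segment (hφ z) fun s hs => ?_
    rw [segment_y, mul_zero, add_zero]
    exact hy _ ⟨hz.1, hY hz.2 hw.2 (by linarith [hs.2]) hs.1 (by ring)⟩
  have h2 : (0 : ℝ) ≤ fderiv ℝ (-φ) z (pt (xPart w) (yPart z) - z) := by
    refine fderiv_nonneg_of_segment (hφ z).neg fun s hs => ?_
    rw [segment_x, mul_zero, add_zero]
    exact neg_le_neg (hx _ ⟨hX hz.1 hw.1 (by linarith [hs.2]) hs.1 (by ring), hz.2⟩)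
  rw [fderiv_neg] at h2
  simp only [neg_apply] at h2
  linarith

/-- For `φ` concave-convex on `K`, the normal cone condition implies the inequalities. -/
theorem isRestrictedSaddle_iff_mem_normalCone {n m : ℕ} {φ : Pt n m → ℝ} {K : Set (Pt n m)}
    (hφ : Differentiable ℝ φ) (hK : ConcaveConvexOn K φ) {z : Pt n m} :
    IsRestrictedSaddle φ K z ↔ z ∈ K ∧ gradField φ z ∈ normalCone K z := by
  refine ⟨fun h => ⟨h.1.1, h.2⟩, fun ⟨hz, hN⟩ => ⟨⟨hz, fun x hx => ?_, fun y hy => ?_⟩, hN⟩⟩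
  · have h1 := hN _ hx
    have h2 : φ (pt x (yPart z)) - φ z ≤ fderiv ℝ φ z (pt x (yPart z) - z) := by
      refine fderiv_nonneg_of_segment (hφ z) fun s hs => ?_
      have := (hK.1 (yPart z)).2 (x := xPart z) (by simpa [pt_parts] using hz) hx
        (sub_nonneg.2 hs.2) hs.1 (by ring)
      have e := segment_x z (pt x (yPart z)) s
      change z + s • (pt x (yPart z) - z) = pt ((1 - s) • xPart z + s • x) (yPart z) at e
      rw [e]
      simp only [pt_parts, smul_eq_mul] at this
      linarith
    rw [inner_gradField] at h1
    change fderiv ℝ φ z (pt x (yPart z) - z) - fderiv ℝ φ z (pt (xPart z) (yPart z) - z) ≤ 0 at h1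
    rw [pt_parts, sub_self, map_zero] at h1
    linarith
  · have h1 := hN _ hy
    have h2 : -(φ (pt (xPart z) y) - φ z) ≤ fderiv ℝ (-φ) z (pt (xPart z) y - z) := by
      refine fderiv_nonneg_of_segment (hφ z).neg fun s hs => ?_
      have := (hK.2 (xPart z)).2 (x := yPart z) (by simpa [pt_parts] using hz) hy
        (sub_nonneg.2 hs.2) hs.1 (by ring)
      have e := segment_y z (pt (xPart z) y) s
      change z + s • (pt (xPart z) y - z) = pt (xPart z) ((1 - s) • yPart z + s • y) at e
      rw [e]
      simp only [pt_parts, smul_eq_mul] at this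
      simp only [Pi.neg_apply]
      linarith
    rw [fderiv_neg] at h2
    simp only [neg_apply] at h2
    rw [inner_gradField] at h1
    change fderiv ℝ φ z (pt (xPart z) (yPart z) - z) - fderiv ℝ φ z (pt (xPart z) y - z) ≤ 0 at h1
    rw [pt_parts, sub_self, map_zero] at h1
    linarith

end SubgradientFaces

/-! The field `f = gradField φ` is dissipative on `C` (`dissipativeOn_gradField`), and normal cones
are monotone, so the distance between two subgradient trajectories never increases
(`norm_sub_antitone`). Most of the argument uses only this, for a continuous `f`, a closed convex
`K` and an equilibrium, a point of `K` where `f` is normal to `K`; for `gradField φ` the equilibria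
are the restricted saddle points.

Trajectories are bounded by their distance to an equilibrium. Although the projected field is
discontinuous, an integrated variational inequality characterizes Lipschitz trajectories and
survives pointwise limits. Limits of time shifts then show that every point of `Ω` starts a
recurrent trajectory (`exists_recurrentTrajectory`). Recurrence turns non-expansion into
conservation: time shifts act isometrically along such trajectories, two of them have common return
times by compactness, and their distance is constant. Conserved distances also allow extension to
negative times, so the semiflow on `Ω` consists of surjective isometries and extends to a flow.

If `u` and `v` keep a constant distance, all dissipation between them vanishes: `f u - f v` and both
normal parts of the velocities are orthogonal to `u - v`. Dissipativity then makes `f` affine on the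
segment from `u` to `v` up to normals of `K`, and convex combinations of `u` and `v` are again
trajectories. Hence `Ω` is convex and the flow on it is affine.

For (i), an invariant compact convex part of `Ω` has an equilibrium well inside it, so each point of
`Ω` is an end point of a segment in `K` through an equilibrium and lies in the minimal face. The
normal part of a velocity is orthogonal to the differences to all equilibria; the face it exposes
contains the minimal face, so it is orthogonal to `V`.

For (ii), an interior saddle point makes the minimal face all of `K`, so no normal part is left.
Conversely, on a solution at constant distance from an interior saddle point, `f` agrees with its
linearization there, whose quadratic form vanishes on differences of points of the solution. Time
shifts are therefore isometric along it, and the solution is recurrent. -/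

namespace SubgradientFaces

/-! ### Absolutely continuous functions -/

theorem absolutelyContinuousOnInterval_of_dist_le {X Y : Type*} [PseudoMetricSpace X]
    [PseudoMetricSpace Y] {u : ℝ → X} {v : ℝ → Y} {a b c : ℝ}
    (hu : AbsolutelyContinuousOnInterval u a b)
    (h : ∀ s ∈ uIcc a b, ∀ t ∈ uIcc a b, dist (v s) (v t) ≤ c * dist (u s) (u t)) :
    AbsolutelyContinuousOnInterval v a b := by
  have h0 := Tendsto.const_mul c hu
  rw [mul_zero] at h0
  refine squeeze_zero' (.of_forall fun P => Finset.sum_nonneg fun i _ => dist_nonneg) ?_ h0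
  filter_upwards [mem_inf_of_right (mem_principal_self _)] with P hP
  rw [Finset.mul_sum]
  exact Finset.sum_le_sum fun i hi => h _ (hP.1 i hi).1 _ (hP.1 i hi).2

/-- An absolutely continuous function with almost everywhere nonpositive derivative decreases. -/
theorem le_of_ae_hasDerivAt_nonpos {g : ℝ → ℝ} {a b : ℝ} (hab : a ≤ b)
    (hg : AbsolutelyContinuousOnInterval g a b)
    (hd : ∀ᵐ t ∂(volume : Measure ℝ), t ∈ Ioo a b → ∃ d ≤ 0, HasDerivAt g d t) : g b ≤ g a := by
  have h1 := hg.integral_deriv_eq_sub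
  have h2 : ∫ t in a..b, deriv g t ≤ 0 := by
    have h3 : ∫ t in a..b, -deriv g t = ∫ t in a..b, |deriv g t| := by
      refine intervalIntegral.integral_congr_ae ?_
      have hb : ∀ᵐ t ∂(volume : Measure ℝ), t ≠ b := by simp [ae_iff, measure_singleton]
      filter_upwards [hd, hb] with t ht htb hmem
      rw [uIoc_of_le hab] at hmem
      obtain ⟨d, hd0, hd⟩ := ht ⟨hmem.1, lt_of_le_of_ne hmem.2 htb⟩
      rw [hd.deriv, abs_of_nonpos hd0]
    have h4 := intervalIntegral.integral_nonneg hab (f := fun t => |deriv g t|) (μ := volume)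
      fun t _ => abs_nonneg _
    rw [← h3, intervalIntegral.integral_neg] at h4
    linarith
  linarith

theorem absolutelyContinuousOnInterval_norm_sq {E : Type*} [SeminormedAddCommGroup E]
    {z : ℝ → E} {a b : ℝ}
    (hz : AbsolutelyContinuousOnInterval z a b) :
    AbsolutelyContinuousOnInterval (fun t => ‖z t‖ ^ 2) a b := by
  have h : AbsolutelyContinuousOnInterval (fun t => ‖z t‖) a b :=
    absolutelyContinuousOnInterval_of_dist_le (c := 1) hz fun s _ t _ => by
      rw [one_mul, Real.dist_eq, dist_eq_norm]
      exact abs_norm_sub_norm_le _ _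
  have := h.fun_mul h
  simpa only [sq] using this

theorem eventually_mem_of_pos {X : Type*} {K : Set X} {u : ℝ → X}
    (hu : ∀ t, 0 ≤ t → u t ∈ K) {t : ℝ} (ht : 0 < t) :
    ∀ᶠ s in 𝓝 t, u s ∈ K := by
  filter_upwards [Ioi_mem_nhds ht] with s hs using hu s (le_of_lt hs)

section Hilbert

variable {E : Type*} [NormedAddCommGroup E] [InnerProductSpace ℝ E]

theorem absolutelyContinuousOnInterval_inner_left {z : ℝ → E} {a b : ℝ}
    (hz : AbsolutelyContinuousOnInterval z a b) (e : E) :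
    AbsolutelyContinuousOnInterval (fun t => inner ℝ e (z t)) a b :=
  absolutelyContinuousOnInterval_of_dist_le (c := ‖e‖) hz fun s _ t _ => by
    rw [Real.dist_eq, ← inner_sub_right, dist_eq_norm]
    exact abs_real_inner_le_norm _ _

/-- Taking inner products with the total displacement reduces the mean value inequality to the
monotonicity of a scalar absolutely continuous function. -/
theorem norm_sub_le_of_ae_hasDerivAt {z v : ℝ → E} {a b M : ℝ} (hab : a ≤ b)
    (hz : AbsolutelyContinuousOnInterval z a b)
    (hd : ∀ᵐ t ∂(volume : Measure ℝ), t ∈ Ioo a b → HasDerivAt z (v t) t)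
    (hv : ∀ t ∈ Ioo a b, ‖v t‖ ≤ M) : ‖z b - z a‖ ≤ M * (b - a) := by
  set e := z b - z a with he
  have h1 : AbsolutelyContinuousOnInterval (fun t => t * (‖e‖ * M)) a b := by
    refine ContDiffOn.absolutelyContinuousOnInterval ?_
    fun_prop
  have h2 := le_of_ae_hasDerivAt_nonpos hab
    ((absolutelyContinuousOnInterval_inner_left hz e).fun_sub h1) (by
      filter_upwards [hd] with t ht hm
      refine ⟨_, ?_, ((hasDerivAt_const t e).inner ℝ (ht hm)).fun_sub
        ((hasDerivAt_id t).mul_const (‖e‖ * M))⟩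
      have := (real_inner_le_norm e (v t)).trans
        (mul_le_mul_of_nonneg_left (hv t hm) (norm_nonneg e))
      simp only [inner_zero_left, add_zero, one_mul]
      linarith)
  have h3 : ‖e‖ * ‖e‖ ≤ ‖e‖ * (M * (b - a)) := by
    rw [← real_inner_self_eq_norm_mul_norm]
    nth_rewrite 2 [he]
    rw [inner_sub_right]
    linarith
  by_cases h0 : ‖e‖ = 0
  · rcases eq_or_lt_of_le hab with rfl | hlt
    · simp [h0]
    · have hne : (Ioo a b).Nonempty := nonempty_Ioo.2 hlt
      obtain ⟨t, ht⟩ := hne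
      have := (norm_nonneg _).trans (hv t ht)
      rw [h0]
      exact mul_nonneg this (by linarith)
  · exact le_of_mul_le_mul_left h3 (lt_of_le_of_ne (norm_nonneg e) (Ne.symm h0))

/-! ### Normal cones and projections -/

theorem zero_mem_normalCone (K : Set E) (z : E) : (0 : E) ∈ normalCone K z := fun w _ => by simp

/-- The obtuse angle criterion. Since `proj` chooses some nearest point, the inequality must also
give uniqueness, which the estimate `key` does. -/
theorem proj_eq_of_inner_le {A : Set E} {v p : E} (hp : p ∈ A)
    (h : ∀ q ∈ A, inner ℝ (v - p) (q - p) ≤ 0) : proj A v = p := by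
  have key : ∀ q ∈ A, ‖v - p‖ ^ 2 + ‖q - p‖ ^ 2 ≤ ‖v - q‖ ^ 2 := fun q hq => by
    have e : v - q = (v - p) - (q - p) := by abel
    rw [e, norm_sub_sq_real (v - p)]
    linarith [h q hq]
  have hex : ∃ p ∈ A, ∀ q ∈ A, dist v p ≤ dist v q := by
    refine ⟨p, hp, fun q hq => ?_⟩
    rw [dist_eq_norm, dist_eq_norm]
    exact le_of_sq_le_sq (by linarith [key q hq, sq_nonneg ‖q - p‖]) (norm_nonneg _)
  rw [proj, dif_pos hex]
  obtain ⟨h1, h2⟩ := hex.choose_spec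
  have h3 := h2 p hp
  rw [dist_eq_norm, dist_eq_norm] at h3
  have h4 := key _ h1
  have h5 := pow_le_pow_left₀ (norm_nonneg _) h3 2
  have h6 : ‖hex.choose - p‖ ^ 2 ≤ 0 := by linarith
  have h7 : ‖hex.choose - p‖ = 0 := by
    have := sq_nonneg ‖hex.choose - p‖
    exact pow_eq_zero_iff two_ne_zero |>.1 (le_antisymm h6 this)
  exact sub_eq_zero.1 (norm_eq_zero.1 h7)

theorem isClosed_normalCone (K : Set E) (z : E) : IsClosed (normalCone K z) := by
  have : normalCone K z = ⋂ w ∈ K, {v | inner ℝ v (w - z) ≤ 0} := by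
    ext v; simp [normalCone]
  rw [this]
  exact isClosed_biInter fun w _ => isClosed_le (by fun_prop) continuous_const

/-- The norm bound compares the nearest point with `0` in the cone. It makes trajectories Lipschitz
wherever `f` is bounded. -/
theorem proj_normalCone_spec [FiniteDimensional ℝ E] (K : Set E) (z v : E) :
    proj (normalCone K z) v ∈ normalCone K z ∧ ‖v - proj (normalCone K z) v‖ ≤ ‖v‖ := by
  have hex : ∃ p ∈ normalCone K z, ∀ q ∈ normalCone K z, dist v p ≤ dist v q := by
    have := FiniteDimensional.proper ℝ E
    obtain ⟨p, hp, h⟩ := (isClosed_normalCone K z).exists_infDist_eq_dist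
      ⟨0, zero_mem_normalCone K z⟩ v
    exact ⟨p, hp, fun q hq => h ▸ Metric.infDist_le_dist_of_mem hq⟩
  rw [proj, dif_pos hex]
  obtain ⟨h1, h2⟩ := hex.choose_spec
  refine ⟨h1, ?_⟩
  simpa [dist_eq_norm] using h2 0 (zero_mem_normalCone K z)

/-- A two-sided derivative of a curve in `K` is orthogonal to all normals. -/
theorem inner_eq_zero_of_mem_normalCone {K : Set E} {u : ℝ → E} {v n : E} {t : ℝ}
    (hu : HasDerivAt u v t) (hK : ∀ᶠ s in 𝓝 t, u s ∈ K) (hn : n ∈ normalCone K (u t)) :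
    inner ℝ n v = 0 := by
  have h1 : HasDerivAt (fun s => inner ℝ n (u s)) (inner ℝ n v) t := by
    simpa using (hasDerivAt_const t n).inner ℝ hu
  refine IsLocalMax.hasDerivAt_eq_zero ?_ h1
  filter_upwards [hK] with s hs
  have := hn _ hs
  rw [inner_sub_right] at this
  linarith

/-- A two-sided velocity is orthogonal to every normal, so the obtuse angle criterion for `w - v`
holds with equality. To identify a trajectory it is thus enough that the field minus the velocity is
a normal. -/
theorem eq_sub_proj_of_hasDerivAt {K : Set E} {u : ℝ → E} {v w : E} {t : ℝ}
    (hu : HasDerivAt u v t) (hK : ∀ᶠ s in 𝓝 t, u s ∈ K) (hn : w - v ∈ normalCone K (u t)) :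
    v = w - proj (normalCone K (u t)) w := by
  rw [proj_eq_of_inner_le hn fun q hq => ?_]
  · abel
  · rw [sub_sub_cancel, real_inner_comm, inner_sub_left,
      inner_eq_zero_of_mem_normalCone hu hK hn, inner_eq_zero_of_mem_normalCone hu hK hq, sub_zero]

/-! ### Projected trajectories of a vector field -/

/-- `f` is dissipative on `K`. -/
def DissipativeOn (f : E → E) (K : Set E) : Prop :=
  ∀ z ∈ K, ∀ w ∈ K, inner ℝ (f z - f w) (z - w) ≤ 0

/-- Carathéodory solutions on `[0, ∞)` in `K` of `ż = f(z) - P_{N_K(z)}(f(z))`. -/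
structure IsProjTrajectory (f : E → E) (K : Set E) (z : ℝ → E) : Prop where
  mem : ∀ t, 0 ≤ t → z t ∈ K
  absolutelyContinuous : ∀ T, 0 ≤ T → AbsolutelyContinuousOnInterval z 0 T
  hasDerivAt : ∀ᵐ t ∂(volume : Measure ℝ), 0 < t →
    HasDerivAt z (f (z t) - proj (normalCone K (z t)) (f (z t))) t

variable {f : E → E} {K : Set E}

theorem IsProjTrajectory.absolutelyContinuous' {z : ℝ → E} (hz : IsProjTrajectory f K z) {s t : ℝ}
    (hs : 0 ≤ s) (hst : s ≤ t) : AbsolutelyContinuousOnInterval z s t :=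
  (hz.absolutelyContinuous t (hs.trans hst)).mono (by
    rw [uIcc_of_le hst, uIcc_of_le (hs.trans hst)]
    exact Icc_subset_Icc_left hs)

theorem IsProjTrajectory.continuousOn {z : ℝ → E} (hz : IsProjTrajectory f K z) :
    ContinuousOn z (Ici 0) := by
  intro t ht
  have h := (hz.absolutelyContinuous (t + 1) (by linarith [mem_Ici.1 ht])).continuousOn
  rw [uIcc_of_le (by linarith [mem_Ici.1 ht])] at h
  have h2 := h t ⟨ht, by linarith⟩
  refine h2.mono_of_mem_nhdsWithin ?_
  filter_upwards [self_mem_nhdsWithin, mem_nhdsWithin_of_mem_nhds (Iio_mem_nhds (lt_add_one t))]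
    with s h1 h2 using ⟨h1, le_of_lt h2⟩

theorem inner_sub_nonneg_of_mem_normalCone {z w m n : E} (hz : z ∈ K) (hw : w ∈ K)
    (hm : m ∈ normalCone K z) (hn : n ∈ normalCone K w) : 0 ≤ inner ℝ (m - n) (z - w) := by
  have h1 := hm w hw
  have h2 := hn z hz
  rw [← neg_sub z w, inner_neg_right] at h1
  rw [inner_sub_left]
  linarith

theorem proj_eq_self {A : Set E} {v : E} (hv : v ∈ A) : proj A v = v :=
  proj_eq_of_inner_le hv fun q _ => by simp

theorem isProjTrajectory_const {e : E} (he : e ∈ K) (hfe : f e ∈ normalCone K e) :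
    IsProjTrajectory f K fun _ => e := by
  refine ⟨fun _ _ => he, fun T _ => ?_, .of_forall fun t _ => ?_⟩
  · exact ContDiffOn.absolutelyContinuousOnInterval contDiffOn_const
  · rw [proj_eq_self hfe, sub_self]
    exact hasDerivAt_const t e

variable [FiniteDimensional ℝ E]

/-- The derivative of the squared distance has a part from `f`, nonpositive by dissipativity, and a
part from the normals, nonpositive by monotonicity of the normal cones. -/
theorem IsProjTrajectory.norm_sub_antitone (hd : DissipativeOn f K) {z w : ℝ → E}
    (hz : IsProjTrajectory f K z) (hw : IsProjTrajectory f K w) {s t : ℝ} (hs : 0 ≤ s)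
    (hst : s ≤ t) : ‖z t - w t‖ ≤ ‖z s - w s‖ := by
  refine le_of_sq_le_sq ?_ (norm_nonneg _)
  refine le_of_ae_hasDerivAt_nonpos (g := fun r => ‖z r - w r‖ ^ 2) hst
    (absolutelyContinuousOnInterval_norm_sq
      ((hz.absolutelyContinuous' hs hst).fun_sub (hw.absolutelyContinuous' hs hst))) ?_
  filter_upwards [hz.hasDerivAt, hw.hasDerivAt] with r h1 h2 hr
  have hr0 : 0 < r := hs.trans_lt hr.1
  refine ⟨_, ?_, ((h1 hr0).fun_sub (h2 hr0)).norm_sq⟩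
  have h3 := hd _ (hz.mem r hr0.le) _ (hw.mem r hr0.le)
  have h4 := inner_sub_nonneg_of_mem_normalCone (hz.mem r hr0.le) (hw.mem r hr0.le)
    (proj_normalCone_spec K (z r) (f (z r))).1 (proj_normalCone_spec K (w r) (f (w r))).1
  rw [real_inner_comm, sub_sub_sub_comm, inner_sub_left]
  linarith

theorem IsProjTrajectory.norm_sub_le (hd : DissipativeOn f K) {z : ℝ → E} {e : E}
    (he : e ∈ K) (hfe : f e ∈ normalCone K e) (hz : IsProjTrajectory f K z) {t : ℝ} (ht : 0 ≤ t) :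
    ‖z t - e‖ ≤ ‖z 0 - e‖ :=
  hz.norm_sub_antitone hd (isProjTrajectory_const he hfe) le_rfl ht

theorem IsProjTrajectory.lipschitz {z : ℝ → E} (hz : IsProjTrajectory f K z) {M : ℝ}
    (hM : ∀ t, 0 ≤ t → ‖f (z t)‖ ≤ M) {s t : ℝ} (hs : 0 ≤ s) (hst : s ≤ t) :
    ‖z t - z s‖ ≤ M * (t - s) := by
  refine norm_sub_le_of_ae_hasDerivAt hst (hz.absolutelyContinuous' hs hst)
    (v := fun r => f (z r) - proj (normalCone K (z r)) (f (z r))) ?_ fun r hr => ?_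
  · filter_upwards [hz.hasDerivAt] with r h hr using h (hs.trans_lt hr.1)
  · exact (proj_normalCone_spec K _ _).2.trans (hM r (hs.trans hr.1.le))

/-- The integrated variational inequality satisfied by trajectories. -/
theorem IsProjTrajectory.variational (hf : Continuous f) {z : ℝ → E}
    (hz : IsProjTrajectory f K z) {q : E} (hq : q ∈ K) {s t : ℝ} (hs : 0 ≤ s) (hst : s ≤ t) :
    ‖z t - q‖ ^ 2 - ‖z s - q‖ ^ 2 ≤ ∫ r in s..t, 2 * inner ℝ (f (z r)) (z r - q) := by
  have hcont : ContinuousOn (fun r => 2 * inner ℝ (f (z r)) (z r - q)) (Ici 0) := by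
    have := hz.continuousOn
    have h2 : ContinuousOn (fun r => f (z r)) (Ici 0) := hf.comp_continuousOn this
    fun_prop
  have hci : ContinuousOn (fun r => 2 * inner ℝ (f (z r)) (z r - q)) (Icc s t) :=
    hcont.mono fun r hr => hs.trans hr.1
  have hint : IntervalIntegrable (fun r => 2 * inner ℝ (f (z r)) (z r - q)) volume s t :=
    ContinuousOn.intervalIntegrable (by rwa [uIcc_of_le hst])
  have h1 : AbsolutelyContinuousOnInterval
      (fun x => ∫ r in s..x, 2 * inner ℝ (f (z r)) (z r - q)) s t :=
    hint.absolutelyContinuousOnInterval_intervalIntegral (by simp [hst])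
  have h2 := le_of_ae_hasDerivAt_nonpos hst
    ((absolutelyContinuousOnInterval_norm_sq ((hz.absolutelyContinuous' hs hst).fun_sub
      (show AbsolutelyContinuousOnInterval (fun _ => q) s t from
        ContDiffOn.absolutelyContinuousOnInterval contDiffOn_const))).fun_sub h1) (by
      filter_upwards [hz.hasDerivAt] with r h hr
      have hr0 : 0 < r := hs.trans_lt hr.1
      have hcr : ContinuousAt (fun r => 2 * inner ℝ (f (z r)) (z r - q)) r :=
        hci.continuousAt (Icc_mem_nhds hr.1 hr.2)
      refine ⟨_, ?_, ((h hr0).sub_const q).norm_sq.fun_sub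
        (intervalIntegral.integral_hasDerivAt_right
          (hint.mono_set (by
            rw [uIcc_of_le hst, uIcc_of_le hr.1.le]
            exact Icc_subset_Icc_right hr.2.le))
          (hcont.mono Ioi_subset_Ici_self |>.stronglyMeasurableAtFilter isOpen_Ioi r hr0) hcr)⟩
      have h4 := (proj_normalCone_spec K (z r) (f (z r))).1 q hq
      rw [← neg_sub (z r) q, inner_neg_right] at h4
      rw [real_inner_comm, inner_sub_left]
      linarith)
  simp only [intervalIntegral.integral_same, sub_zero] at h2
  linarith

/-- Lipschitz curves in `K` satisfying the integrated variational inequality are trajectories. -/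
theorem isProjTrajectory_of_variational (hf : Continuous f) {u : ℝ → E} {M : ℝ}
    (hmem : ∀ t, 0 ≤ t → u t ∈ K)
    (hlip : ∀ s t, 0 ≤ s → s ≤ t → ‖u t - u s‖ ≤ M * (t - s))
    (hvar : ∀ q ∈ K, ∀ s t, 0 ≤ s → s ≤ t →
      ‖u t - q‖ ^ 2 - ‖u s - q‖ ^ 2 ≤ ∫ r in s..t, 2 * inner ℝ (f (u r)) (u r - q)) :
    IsProjTrajectory f K u := by
  have hL : LipschitzOnWith M.toNNReal u (Ici 0) := by
    refine LipschitzOnWith.of_dist_le_mul fun s hs t ht => ?_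
    have key : ∀ s t, 0 ≤ s → s ≤ t → dist (u s) (u t) ≤ M.toNNReal * dist s t := by
      intro s t hs hst
      rw [dist_comm, dist_eq_norm, dist_comm, Real.dist_eq, abs_of_nonneg (sub_nonneg.2 hst)]
      exact (hlip s t hs hst).trans
        (mul_le_mul_of_nonneg_right (Real.le_coe_toNNReal M) (sub_nonneg.2 hst))
    rcases le_total s t with h | h
    · exact key s t hs h
    · rw [dist_comm, dist_comm s]; exact key t s ht h
  refine ⟨hmem, fun T hT => ?_, ?_⟩
  · refine LipschitzOnWith.absolutelyContinuousOnInterval (K := M.toNNReal) (hL.mono ?_)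
    rw [uIcc_of_le hT]
    exact Icc_subset_Ici_self
  -- By Rademacher, `u` is differentiable almost everywhere; the variational inequality, divided by
  -- the length of a shrinking interval, makes `f (u t) - deriv u t` a normal.
  · filter_upwards [hL.ae_differentiableWithinAt_of_mem_real] with t h1 ht
    have hdiff : HasDerivAt u (deriv u t) t :=
      ((h1 ht.le).differentiableAt (Ici_mem_nhds ht)).hasDerivAt
    have hcont : ∀ q, ContinuousOn (fun r => 2 * inner ℝ (f (u r)) (u r - q)) (Ici 0) := by
      intro q
      have := hL.continuousOn
      have h2 : ContinuousOn (fun r => f (u r)) (Ici 0) := hf.comp_continuousOn this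
      fun_prop
    have hN : f (u t) - deriv u t ∈ normalCone K (u t) := by
      intro q hq
      have hint : ∀ x, 0 ≤ x → IntervalIntegrable
          (fun r => 2 * inner ℝ (f (u r)) (u r - q)) volume t x := fun x hx =>
        ContinuousOn.intervalIntegrable ((hcont q).mono fun r hr =>
          (le_inf ht.le hx).trans hr.1)
      have hD := (hdiff.sub_const q).norm_sq.fun_sub
        (intervalIntegral.integral_hasDerivAt_right (hint t ht.le)
          ((hcont q).mono Ioi_subset_Ici_self |>.stronglyMeasurableAtFilter isOpen_Ioi t ht)
          ((hcont q).continuousAt (Ici_mem_nhds ht)))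
      have hle : 2 * inner ℝ (u t - q) (deriv u t) - 2 * inner ℝ (f (u t)) (u t - q) ≤ 0 := by
        have htd := hD.tendsto_slope_zero_right
        refine le_of_tendsto htd ?_
        filter_upwards [self_mem_nhdsWithin] with h hh
        have hh0 : 0 < h := hh
        have := hvar q hq t (t + h) ht.le (by linarith)
        simp only [intervalIntegral.integral_same, sub_zero, smul_eq_mul]
        refine mul_nonpos_of_nonneg_of_nonpos (inv_nonneg.2 hh0.le) (by linarith)
      rw [real_inner_comm] at hle
      rw [← neg_sub (u t) q, inner_neg_right, inner_sub_left]
      linarith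
    rw [← eq_sub_proj_of_hasDerivAt hdiff (eventually_mem_of_pos hmem ht) hN]
    exact hdiff

/-- Pointwise limits of bounded families of trajectories are trajectories. -/
theorem isProjTrajectory_of_tendsto (hf : Continuous f) (hK : IsClosed K) {z : ℕ → ℝ → E}
    {u : ℝ → E} {R : ℝ} (hz : ∀ k, IsProjTrajectory f K (z k))
    (hR : ∀ k t, 0 ≤ t → ‖z k t‖ ≤ R)
    (hu : ∀ t, 0 ≤ t → Tendsto (fun k => z k t) atTop (𝓝 (u t))) : IsProjTrajectory f K u := by
  have := FiniteDimensional.proper ℝ E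
  obtain ⟨M, hM⟩ := (isCompact_closedBall (0 : E) R).exists_bound_of_continuousOn hf.continuousOn
  have hM' : ∀ k t, 0 ≤ t → ‖f (z k t)‖ ≤ M := fun k t ht => hM _ (by simpa using hR k t ht)
  refine isProjTrajectory_of_variational (M := M) hf
    (fun t ht => hK.mem_of_tendsto (hu t ht) (.of_forall fun k => (hz k).mem t ht))
    (fun s t hs hst => ?_) fun q hq s t hs hst => ?_
  · exact le_of_tendsto ((hu t (hs.trans hst)).sub (hu s hs)).norm
      (.of_forall fun k => (hz k).lipschitz (hM' k) hs hst)
  · refine le_of_tendsto_of_tendsto ((((hu t (hs.trans hst)).sub_const q).norm.pow 2).sub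
      (((hu s hs).sub_const q).norm.pow 2)) ?_
      (.of_forall fun k => (hz k).variational hf hq hs hst)
    refine intervalIntegral.tendsto_integral_filter_of_dominated_convergence
      (fun _ => 2 * (M * (R + ‖q‖))) (.of_forall fun k => ?_) (.of_forall fun k => ?_)
      intervalIntegrable_const (.of_forall fun r hr => ?_)
    · rw [uIoc_of_le hst]
      refine ContinuousOn.aestronglyMeasurable ?_ measurableSet_Ioc
      have h1 : ContinuousOn (z k) (Ioc s t) :=
        (hz k).continuousOn.mono fun r hr => hs.trans hr.1.le
      have h2 : ContinuousOn (fun r => f (z k r)) (Ioc s t) := hf.comp_continuousOn h1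
      fun_prop
    · refine .of_forall fun r hr => ?_
      rw [uIoc_of_le hst] at hr
      have hr0 := hs.trans hr.1.le
      have h1 := hM' k r hr0
      have h2 : ‖z k r - q‖ ≤ R + ‖q‖ := (_root_.norm_sub_le _ _).trans (by linarith [hR k r hr0])
      rw [norm_mul, Real.norm_ofNat]
      refine mul_le_mul_of_nonneg_left ((norm_inner_le_norm _ _).trans ?_) zero_le_two
      exact mul_le_mul h1 h2 (norm_nonneg _) ((norm_nonneg _).trans h1)
    · rw [uIoc_of_le hst] at hr
      have h1 := hu r (hs.trans hr.1.le)
      exact (((hf.tendsto _).comp h1).inner (h1.sub_const q)).const_mul 2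

/-- Time shifts of bounded trajectories are trajectories. -/
theorem IsProjTrajectory.shift (hf : Continuous f) (hd : DissipativeOn f K) {e : E}
    (he : e ∈ K) (hfe : f e ∈ normalCone K e) {z : ℝ → E} (hz : IsProjTrajectory f K z) {a : ℝ}
    (ha : 0 ≤ a) : IsProjTrajectory f K fun t => z (a + t) := by
  have := FiniteDimensional.proper ℝ E
  obtain ⟨M, hM⟩ := (isCompact_closedBall e ‖z 0 - e‖).exists_bound_of_continuousOn hf.continuousOn
  have hM' : ∀ t, 0 ≤ t → ‖f (z t)‖ ≤ M := fun t ht =>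
    hM _ (by simpa [dist_eq_norm] using hz.norm_sub_le hd he hfe ht)
  refine isProjTrajectory_of_variational (M := M) hf (fun t ht => hz.mem _ (by linarith))
    (fun s t hs hst => ?_) fun q hq s t hs hst => ?_
  · have := hz.lipschitz hM' (s := a + s) (t := a + t) (by linarith) (by linarith)
    rwa [add_sub_add_left_eq_sub] at this
  · have := hz.variational hf hq (s := a + s) (t := a + t) (by linarith) (by linarith)
    rwa [intervalIntegral.integral_comp_add_left
      (fun r => 2 * inner ℝ (f (z r)) (z r - q))]

end Hilbert

section Omega

variable {E : Type*} [NormedAddCommGroup E] [InnerProductSpace ℝ E]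

/-! ### Recurrent trajectories -/

/-- The union of the `ω`-limit sets of the trajectories of `f` projected to `K`. -/
def projOmega (f : E → E) (K : Set E) : Set E :=
  {p | ∃ z, IsProjTrajectory f K z ∧ ∀ t, 0 ≤ t → p ∈ closure (z '' Ici t)}

/-- Trajectories that return arbitrarily late arbitrarily near to their initial points. -/
structure IsRecurrentTrajectory (f : E → E) (K : Set E) (u : ℝ → E) : Prop
    extends IsProjTrajectory f K u where
  recurrent : ∀ ε > 0, ∀ T : ℝ, ∃ t, T ≤ t ∧ 0 ≤ t ∧ ‖u t - u 0‖ < ε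

/-- The vector field at `e` is an outward normal of `K`: `e` is an equilibrium of the
projected field. -/
def IsEquilibrium (f : E → E) (K : Set E) (e : E) : Prop :=
  e ∈ K ∧ f e ∈ normalCone K e

variable {f : E → E} {K : Set E} {e : E}

theorem IsRecurrentTrajectory.mem_projOmega {u : ℝ → E} (hu : IsRecurrentTrajectory f K u) :
    u 0 ∈ projOmega f K := by
  refine ⟨u, hu.toIsProjTrajectory, fun t _ => Metric.mem_closure_iff.2 fun ε hε => ?_⟩
  obtain ⟨s, hs, -, h⟩ := hu.recurrent ε hε t
  exact ⟨u s, mem_image_of_mem u hs, by rwa [dist_comm, dist_eq_norm]⟩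

theorem isRecurrentTrajectory_const (he : IsEquilibrium f K e) :
    IsRecurrentTrajectory f K fun _ => e :=
  ⟨isProjTrajectory_const he.1 he.2, fun ε hε T =>
    ⟨max T 0, le_max_left _ _, le_max_right _ _, by simpa using hε⟩⟩

/-- If `f` is dissipative on `K` and conserves the distance of `z` and `w` to first order, then
it is affine on the segment joining them, up to normals of `K`. -/
theorem sub_mem_normalCone_of_inner_eq_zero (hf : Continuous f) (hKc : Convex ℝ K)
    (hd : DissipativeOn f K) {z w : E} (hz : z ∈ K) (hw : w ∈ K)
    (h0 : inner ℝ (f z - f w) (z - w) = 0) {a b : ℝ} (ha : 0 ≤ a) (hb : 0 ≤ b) (hab : a + b = 1) :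
    f (a • z + b • w) - (a • f z + b • f w) ∈ normalCone K (a • z + b • w) := by
  intro q hq
  set m := a • z + b • w with hm
  have hmK : m ∈ K := hKc hz hw ha hb hab
  -- Dissipativity is tested on the point moved slightly from `m` towards `q`, against `z` with
  -- weight `a` and `w` with weight `b`. In the weighted sum the terms in `z - w` combine to a
  -- multiple of `h0`, leaving a multiple of `ε`.
  have key : ∀ ε ∈ Ioc (0 : ℝ) 1,
      inner ℝ (f (m + ε • (q - m)) - (a • f z + b • f w)) (q - m) ≤ 0 := by
    intro ε hε
    set p := m + ε • (q - m) with hp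
    have hpK : p ∈ K := hKc.add_smul_sub_mem hmK hq ⟨hε.1.le, hε.2⟩
    have h1 := hd _ hz _ hpK
    have h2 := hd _ hw _ hpK
    have e1 : z - p = b • (z - w) - ε • (q - m) := by
      obtain rfl : a = 1 - b := by linarith
      rw [hp, hm]; module
    have e2 : w - p = -(a • (z - w)) - ε • (q - m) := by
      obtain rfl : b = 1 - a := by linarith
      rw [hp, hm]; module
    rw [e1] at h1
    rw [e2] at h2
    simp only [inner_sub_left, inner_sub_right, inner_neg_right, inner_smul_right,
      inner_smul_left, inner_add_left, RCLike.conj_to_real] at h0 h1 h2 ⊢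
    have h3 := add_nonpos (mul_nonpos_of_nonneg_of_nonpos ha h1)
      (mul_nonpos_of_nonneg_of_nonpos hb h2)
    refine nonpos_of_mul_nonpos_right (a := ε) ?_ hε.1
    obtain rfl : b = 1 - a := by linarith
    linear_combination h3 - a * (1 - a) * h0
  have hlim : Tendsto (fun ε : ℝ => inner ℝ (f (m + ε • (q - m)) - (a • f z + b • f w)) (q - m))
      (𝓝[>] 0) (𝓝 (inner ℝ (f m - (a • f z + b • f w)) (q - m))) := by
    have hc : Continuous fun ε : ℝ =>
        inner ℝ (f (m + ε • (q - m)) - (a • f z + b • f w)) (q - m) := by fun_prop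
    have := hc.tendsto 0
    simp only [zero_smul, add_zero] at this
    exact this.mono_left nhdsWithin_le_nhds
  refine le_of_tendsto hlim ?_
  filter_upwards [Ioc_mem_nhdsGT (zero_lt_one' ℝ)] with ε hε using key ε hε

theorem IsRecurrentTrajectory.congr {u v : ℝ → E} (hu : IsRecurrentTrajectory f K u)
    (h : ∀ t, 0 ≤ t → v t = u t) : IsRecurrentTrajectory f K v := by
  refine ⟨⟨fun t ht => h t ht ▸ hu.mem t ht, fun T hT => ?_, ?_⟩, fun ε hε T => ?_⟩
  · refine absolutelyContinuousOnInterval_of_dist_le (c := 1) (hu.absolutelyContinuous T hT)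
      fun s hs t ht => ?_
    rw [uIcc_of_le hT] at hs ht
    rw [h s hs.1, h t ht.1, one_mul]
  · filter_upwards [hu.hasDerivAt] with t h1 ht
    rw [h t ht.le]
    refine (h1 ht).congr_of_eventuallyEq ?_
    filter_upwards [Ioi_mem_nhds ht] with s hs using h s (le_of_lt hs)
  · obtain ⟨t, hT, ht, h1⟩ := hu.recurrent ε hε T
    exact ⟨t, hT, ht, by rwa [h t ht, h 0 le_rfl]⟩

variable [FiniteDimensional ℝ E]

/-- By non-expansion, convergence of the initial points makes the trajectories Cauchy at every later
time; the equilibrium bounds them uniformly. -/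
theorem exists_limit_trajectory (hf : Continuous f) (hK : IsClosed K) (hd : DissipativeOn f K)
    (he : IsEquilibrium f K e) {z : ℕ → ℝ → E} (hz : ∀ k, IsProjTrajectory f K (z k)) {p : E}
    (hp : Tendsto (fun k => z k 0) atTop (𝓝 p)) :
    ∃ u, IsProjTrajectory f K u ∧ u 0 = p ∧
      ∀ t, 0 ≤ t → Tendsto (fun k => z k t) atTop (𝓝 (u t)) := by
  have hlim : ∀ t, ∃ l, 0 ≤ t → Tendsto (fun k => z k t) atTop (𝓝 l) := by
    intro t
    by_cases ht : 0 ≤ t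
    · have hc : CauchySeq fun k => z k t := by
        rw [Metric.cauchySeq_iff]
        intro ε hε
        obtain ⟨N, hN⟩ := Metric.cauchySeq_iff.1 hp.cauchySeq ε hε
        refine ⟨N, fun i hi j hj => lt_of_le_of_lt ?_ (hN i hi j hj)⟩
        rw [dist_eq_norm, dist_eq_norm]
        exact (hz i).norm_sub_antitone hd (hz j) le_rfl ht
      have := FiniteDimensional.complete ℝ E
      obtain ⟨l, hl⟩ := cauchySeq_tendsto_of_complete hc
      exact ⟨l, fun _ => hl⟩
    · exact ⟨0, fun h => absurd h ht⟩
  choose u hu using hlim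
  obtain ⟨R, hR⟩ := (Metric.isBounded_range_of_tendsto _ hp).exists_norm_le
  refine ⟨u, isProjTrajectory_of_tendsto (R := R + ‖e‖ + ‖e‖) hf hK hz (fun k t ht => ?_) hu,
    tendsto_nhds_unique (hu 0 le_rfl) hp, hu⟩
  have h1 := (hz k).norm_sub_le hd he.1 he.2 ht
  have h2 := norm_sub_le (z k 0) e
  have h3 := hR _ (mem_range_self k)
  have h4 := norm_add_le (z k t - e) e
  rw [sub_add_cancel] at h4
  linarith

/-- By non-expansion an approximation at time `0` is as good at all later times, so return times of
a nearby trajectory serve for the limit. -/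
theorem IsRecurrentTrajectory.of_tendsto (hd : DissipativeOn f K) {z : ℕ → ℝ → E}
    (hz : ∀ k, IsRecurrentTrajectory f K (z k)) {u : ℝ → E} (hu : IsProjTrajectory f K u)
    (h0 : Tendsto (fun k => z k 0) atTop (𝓝 (u 0))) : IsRecurrentTrajectory f K u := by
  refine ⟨hu, fun ε hε T => ?_⟩
  obtain ⟨k, hk⟩ := (Metric.tendsto_nhds.1 h0 (ε / 3) (by linarith)).exists
  obtain ⟨t, hT, ht, h⟩ := (hz k).recurrent (ε / 3) (by linarith) T
  refine ⟨t, hT, ht, ?_⟩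
  rw [dist_eq_norm] at hk
  have h1 := (hz k).norm_sub_antitone hd hu le_rfl ht
  have e1 : u t - u 0 = -(z k t - u t) + (z k t - z k 0) + (z k 0 - u 0) := by abel
  rw [e1]
  have h2 := norm_add₃_le (a := -(z k t - u t)) (b := z k t - z k 0) (c := z k 0 - u 0)
  rw [norm_neg] at h2
  linarith

/-- The trajectory `u` is the limit of `z` shifted by times `τ k` at which `z` approaches `p`. It
shadows `z (τ N + ·)` for all time, so `τ l - τ N` is a return time when `l` is large. -/
theorem exists_recurrentTrajectory (hf : Continuous f) (hK : IsClosed K)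
    (hd : DissipativeOn f K) (he : IsEquilibrium f K e) {p : E} (hp : p ∈ projOmega f K) :
    ∃ u, IsRecurrentTrajectory f K u ∧ u 0 = p := by
  obtain ⟨z, hz, hcl⟩ := hp
  have hex : ∀ k : ℕ, ∃ t : ℝ, (k : ℝ) ≤ t ∧ dist p (z t) < 1 / ((k : ℝ) + 1) := by
    intro k
    obtain ⟨_, ⟨t, ht, rfl⟩, h⟩ := Metric.mem_closure_iff.1 (hcl k (Nat.cast_nonneg k))
      (1 / ((k : ℝ) + 1)) (by positivity)
    exact ⟨t, ht, h⟩
  choose τ hτ1 hτ2 using hex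
  have hτ0 : ∀ k, 0 ≤ τ k := fun k => (Nat.cast_nonneg k).trans (hτ1 k)
  have hlim : Tendsto (fun k => z (τ k)) atTop (𝓝 p) := by
    rw [tendsto_iff_dist_tendsto_zero]
    refine squeeze_zero (fun _ => dist_nonneg) (fun k => ?_)
      (tendsto_one_div_add_atTop_nhds_zero_nat (𝕜 := ℝ))
    rw [dist_comm]
    exact (hτ2 k).le
  have hsh : ∀ k, IsProjTrajectory f K fun t => z (τ k + t) := fun k =>
    hz.shift hf hd he.1 he.2 (hτ0 k)
  obtain ⟨u, hu, hu0, -⟩ := exists_limit_trajectory hf hK hd he hsh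
    (p := p) (by simpa using hlim)
  refine ⟨u, ⟨hu, fun ε hε T => ?_⟩, hu0⟩
  obtain ⟨N, hN⟩ := Metric.tendsto_atTop.1 hlim (ε / 2) (by linarith)
  obtain ⟨l, hl⟩ := exists_nat_ge (max (N : ℝ) (τ N + max T 0))
  have hlN : N ≤ l := by exact_mod_cast (le_max_left _ _).trans hl
  have hs : max T 0 ≤ τ l - τ N := by
    have := ((le_max_right _ _).trans hl).trans (hτ1 l)
    linarith
  have hs0 : 0 ≤ τ l - τ N := (le_max_right _ _).trans hs
  refine ⟨τ l - τ N, (le_max_left _ _).trans hs, hs0, ?_⟩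
  have h1 := hu.norm_sub_antitone hd (hsh N) le_rfl hs0
  have h2 := hN N le_rfl
  have h3 := hN l hlN
  simp only [add_sub_cancel, add_zero] at h1
  rw [dist_eq_norm] at h2 h3
  rw [hu0] at h1 ⊢
  rw [norm_sub_rev p] at h1
  have e1 : u (τ l - τ N) - p = (u (τ l - τ N) - z (τ l)) + (z (τ l) - p) := by abel
  rw [e1]
  linarith [norm_add_le (u (τ l - τ N) - z (τ l)) (z (τ l) - p)]

/-- The time shifts act isometrically along a recurrent trajectory. -/
theorem IsRecurrentTrajectory.norm_sub_shift (hf : Continuous f) (hd : DissipativeOn f K)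
    (he : IsEquilibrium f K e) {u : ℝ → E} (hu : IsRecurrentTrajectory f K u) {r s : ℝ}
    (hr : 0 ≤ r) (hs : 0 ≤ s) : ‖u (r + s) - u r‖ = ‖u s - u 0‖ := by
  have hsh : ∀ a, 0 ≤ a → IsProjTrajectory f K fun t => u (a + t) := fun a ha =>
    hu.shift hf hd he.1 he.2 ha
  refine le_antisymm ?_ (le_of_forall_pos_le_add fun ε hε => ?_)
  · have := (hsh s hs).norm_sub_antitone hd hu.toIsProjTrajectory le_rfl hr
    simpa [add_comm s r] using this
  -- After an almost return at `t ≥ r`, the pair `u t`, `u (t + s)` is close to `u 0`, `u s`, while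
  -- its distance is at most that of `u r`, `u (r + s)`.
  · obtain ⟨t, hrt, ht, h⟩ := hu.recurrent (ε / 2) (by linarith) r
    have h1 := (hsh t ht).norm_sub_antitone hd hu.toIsProjTrajectory le_rfl hs
    have h2 := (hsh s hs).norm_sub_antitone hd hu.toIsProjTrajectory hr hrt
    simp only [add_zero, add_comm s] at h1 h2
    have e1 : u s - u 0 = -(u (t + s) - u s) + (u (t + s) - u t) + (u t - u 0) := by abel
    rw [e1]
    have h3 := norm_add₃_le (a := -(u (t + s) - u s)) (b := u (t + s) - u t) (c := u t - u 0)
    rw [norm_neg] at h3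
    linarith

/-- Bounded curves on which time shifts act isometrically are simultaneously recurrent. -/
theorem exists_simultaneous_return {u v : ℝ → E} {R : ℝ} (hu : ∀ t, 0 ≤ t → ‖u t‖ ≤ R)
    (hv : ∀ t, 0 ≤ t → ‖v t‖ ≤ R)
    (hui : ∀ r s, 0 ≤ r → 0 ≤ s → ‖u (r + s) - u r‖ = ‖u s - u 0‖)
    (hvi : ∀ r s, 0 ≤ r → 0 ≤ s → ‖v (r + s) - v r‖ = ‖v s - v 0‖) {ε : ℝ} (hε : 0 < ε) (T : ℝ) :
    ∃ t, T ≤ t ∧ 0 ≤ t ∧ ‖u t - u 0‖ < ε ∧ ‖v t - v 0‖ < ε := by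
  have := FiniteDimensional.proper ℝ E
  have hmem : ∀ k : ℕ, (u k, v k) ∈ Metric.closedBall (0 : E) R ×ˢ Metric.closedBall (0 : E) R :=
    fun k => ⟨by simpa using hu k k.cast_nonneg, by simpa using hv k k.cast_nonneg⟩
  obtain ⟨p, -, φ, hφ, hlim⟩ :=
    ((isCompact_closedBall (0 : E) R).prod (isCompact_closedBall (0 : E) R)).tendsto_subseq hmem
  obtain ⟨N, hN⟩ := Metric.cauchySeq_iff.1 hlim.cauchySeq ε hε
  obtain ⟨l, hl⟩ := exists_nat_ge (max 0 T)
  -- Both curves are nearly equal at the integer times `φ N` and `φ (l + N)`; the shift isometry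
  -- moves this to time `0`. The gap is at least `l`, hence at least `T`.
  have h1 : φ N + l ≤ φ (l + N) := by rw [add_comm]; exact hφ.add_le_nat l N
  obtain ⟨s, hs⟩ := Nat.exists_eq_add_of_le h1
  have h2 := hN (l + N) (Nat.le_add_left _ _) N le_rfl
  simp only [Function.comp] at h2
  rw [Prod.dist_eq, max_lt_iff, dist_eq_norm, dist_eq_norm] at h2
  have hcast : ((φ (l + N) : ℕ) : ℝ) = (φ N : ℝ) + ((l + s : ℕ) : ℝ) := by
    rw [hs]; push_cast; ring
  rw [hcast, hui _ _ (Nat.cast_nonneg _) (Nat.cast_nonneg _),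
    hvi _ _ (Nat.cast_nonneg _) (Nat.cast_nonneg _)] at h2
  refine ⟨((l + s : ℕ) : ℝ), ?_, Nat.cast_nonneg _, h2⟩
  push_cast
  linarith [le_max_right (0 : ℝ) T, (Nat.cast_nonneg s : (0 : ℝ) ≤ s)]

theorem IsProjTrajectory.norm_le (hd : DissipativeOn f K) (he : IsEquilibrium f K e) {u : ℝ → E}
    (hu : IsProjTrajectory f K u) {t : ℝ} (ht : 0 ≤ t) : ‖u t‖ ≤ ‖u 0 - e‖ + ‖e‖ := by
  have h1 := hu.norm_sub_le hd he.1 he.2 ht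
  have h2 := norm_add_le (u t - e) e
  rw [sub_add_cancel] at h2
  linarith

theorem IsRecurrentTrajectory.exists_simultaneous_return (hf : Continuous f)
    (hd : DissipativeOn f K) (he : IsEquilibrium f K e) {u v : ℝ → E}
    (hu : IsRecurrentTrajectory f K u) (hv : IsRecurrentTrajectory f K v) {ε : ℝ} (hε : 0 < ε)
    (T : ℝ) : ∃ t, T ≤ t ∧ 0 ≤ t ∧ ‖u t - u 0‖ < ε ∧ ‖v t - v 0‖ < ε :=
  SubgradientFaces.exists_simultaneous_return
    (R := max (‖u 0 - e‖ + ‖e‖) (‖v 0 - e‖ + ‖e‖))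
    (fun _ ht => (hu.norm_le hd he ht).trans (le_max_left _ _))
    (fun _ ht => (hv.norm_le hd he ht).trans (le_max_right _ _))
    (fun _ _ hr hs => hu.norm_sub_shift hf hd he hr hs)
    (fun _ _ hr hs => hv.norm_sub_shift hf hd he hr hs) hε T

theorem IsRecurrentTrajectory.shift (hf : Continuous f)
    (hd : DissipativeOn f K) (he : IsEquilibrium f K e) {u : ℝ → E}
    (hu : IsRecurrentTrajectory f K u) {a : ℝ} (ha : 0 ≤ a) :
    IsRecurrentTrajectory f K fun t => u (a + t) := by
  refine ⟨hu.toIsProjTrajectory.shift hf hd he.1 he.2 ha, fun ε hε T => ?_⟩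
  obtain ⟨t, hT, ht, h⟩ := hu.recurrent ε hε T
  refine ⟨t, hT, ht, ?_⟩
  rw [add_zero, hu.norm_sub_shift hf hd he ha ht]
  exact h

/-- The distance of two recurrent trajectories is constant. -/
theorem IsRecurrentTrajectory.norm_sub_eq (hf : Continuous f)
    (hd : DissipativeOn f K) (he : IsEquilibrium f K e) {u v : ℝ → E}
    (hu : IsRecurrentTrajectory f K u) (hv : IsRecurrentTrajectory f K v) {t : ℝ} (ht : 0 ≤ t) :
    ‖u t - v t‖ = ‖u 0 - v 0‖ := by
  refine le_antisymm (hu.norm_sub_antitone hd hv.toIsProjTrajectory le_rfl ht)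
    (le_of_forall_pos_le_add fun ε hε => ?_)
  obtain ⟨s, hts, hs, h1, h2⟩ :=
    hu.exists_simultaneous_return hf hd he hv (ε := ε / 2) (by linarith) t
  have h3 := hu.norm_sub_antitone hd hv.toIsProjTrajectory ht hts
  have e1 : u 0 - v 0 = -(u s - u 0) + (u s - v s) + (v s - v 0) := by abel
  rw [e1]
  have h4 := norm_add₃_le (a := -(u s - u 0)) (b := u s - v s) (c := v s - v 0)
  rw [norm_neg] at h4
  linarith

/-! ### Convexity of the `ω`-limit set -/

/-- The normal parts of the velocities of trajectories at constant distance. -/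
theorem IsProjTrajectory.inner_eq_zero (hd : DissipativeOn f K) {u v : ℝ → E}
    (hu : IsProjTrajectory f K u) (hv : IsProjTrajectory f K v)
    (huv : ∀ t, 0 ≤ t → ‖u t - v t‖ = ‖u 0 - v 0‖) {t : ℝ} (ht : 0 < t)
    (h1 : HasDerivAt u (f (u t) - proj (normalCone K (u t)) (f (u t))) t)
    (h2 : HasDerivAt v (f (v t) - proj (normalCone K (v t)) (f (v t))) t) :
    inner ℝ (f (u t) - f (v t)) (u t - v t) = 0 ∧
      inner ℝ (proj (normalCone K (u t)) (f (u t))) (u t - v t) = 0 ∧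
      inner ℝ (proj (normalCone K (v t)) (f (v t))) (u t - v t) = 0 := by
  have h3 := (h1.fun_sub h2).norm_sq
  have h4 : HasDerivAt (fun r => ‖u r - v r‖ ^ 2) 0 t := by
    refine (hasDerivAt_const t (‖u 0 - v 0‖ ^ 2)).congr_of_eventuallyEq ?_
    filter_upwards [Ioi_mem_nhds ht] with r hr
    rw [huv r (le_of_lt hr)]
  have h5 := h3.unique h4
  have h6 := hd _ (hu.mem t ht.le) _ (hv.mem t ht.le)
  have h7 := (proj_normalCone_spec K (u t) (f (u t))).1 _ (hv.mem t ht.le)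
  have h8 := (proj_normalCone_spec K (v t) (f (v t))).1 _ (hu.mem t ht.le)
  rw [← neg_sub (u t), inner_neg_right] at h7
  rw [real_inner_comm, sub_sub_sub_comm, inner_sub_left,
    inner_sub_left (proj (normalCone K (u t)) (f (u t)))] at h5
  -- The vanishing derivative of the squared distance is twice a sum of three nonpositive terms, so
  -- each term vanishes.
  refine ⟨?_, ?_, ?_⟩ <;> linarith

/-- The field minus the velocity is the affine defect of `f`, a normal by
`sub_mem_normalCone_of_inner_eq_zero`, plus `a • n + b • n'`. Being orthogonal to `u t - v t`, the
normals `n` and `n'` remain normals at the combined point. -/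
theorem IsProjTrajectory.convexCombination (hf : Continuous f) (hKc : Convex ℝ K)
    (hd : DissipativeOn f K) {u v : ℝ → E}
    (hu : IsProjTrajectory f K u) (hv : IsProjTrajectory f K v)
    (huv : ∀ t, 0 ≤ t → ‖u t - v t‖ = ‖u 0 - v 0‖) {a b : ℝ} (ha : 0 ≤ a) (hb : 0 ≤ b)
    (hab : a + b = 1) : IsProjTrajectory f K fun t => a • u t + b • v t := by
  have hmem : ∀ t, 0 ≤ t → a • u t + b • v t ∈ K := fun t ht =>
    hKc (hu.mem t ht) (hv.mem t ht) ha hb hab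
  refine ⟨hmem, fun T hT => ?_, ?_⟩
  · exact ((hu.absolutelyContinuous T hT).const_smul a).fun_add
      ((hv.absolutelyContinuous T hT).const_smul b)
  · filter_upwards [hu.hasDerivAt, hv.hasDerivAt] with t h1 h2 ht
    obtain ⟨h3, h4, h5⟩ := hu.inner_eq_zero hd hv huv ht (h1 ht) (h2 ht)
    have hD := ((h1 ht).fun_const_smul a).fun_add ((h2 ht).fun_const_smul b)
    refine (eq_sub_proj_of_hasDerivAt hD (eventually_mem_of_pos hmem ht) ?_) ▸ hD
    have h6 := sub_mem_normalCone_of_inner_eq_zero hf hKc hd (hu.mem t ht.le) (hv.mem t ht.le) h3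
      ha hb hab
    have h7 := (proj_normalCone_spec K (u t) (f (u t))).1
    have h8 := (proj_normalCone_spec K (v t) (f (v t))).1
    generalize proj (normalCone K (u t)) (f (u t)) = n at *
    generalize proj (normalCone K (v t)) (f (v t)) = n' at *
    intro q hq
    have h6 := h6 q hq
    have h7 := h7 q hq
    have h8 := h8 q hq
    have e1 : q - (a • u t + b • v t) = (q - u t) + b • (u t - v t) := by
      obtain rfl : a = 1 - b := by linarith
      module
    have e2 : q - (a • u t + b • v t) = (q - v t) - a • (u t - v t) := by
      obtain rfl : b = 1 - a := by linarith
      module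
    have i1 : inner ℝ n (q - (a • u t + b • v t)) ≤ 0 := by
      rw [e1, inner_add_right, inner_smul_right, h4]; linarith
    have i2 : inner ℝ n' (q - (a • u t + b • v t)) ≤ 0 := by
      rw [e2, inner_sub_right, inner_smul_right, h5]; linarith
    have e3 : f (a • u t + b • v t) - (a • (f (u t) - n) + b • (f (v t) - n')) =
        (f (a • u t + b • v t) - (a • f (u t) + b • f (v t))) + a • n + b • n' := by module
    rw [e3, inner_add_left, inner_add_left, inner_smul_left, inner_smul_left]
    have := mul_nonpos_of_nonneg_of_nonpos ha i1
    have := mul_nonpos_of_nonneg_of_nonpos hb i2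
    simp only [RCLike.conj_to_real]
    linarith

theorem IsRecurrentTrajectory.convexCombination (hf : Continuous f) (hKc : Convex ℝ K)
    (hd : DissipativeOn f K) (he : IsEquilibrium f K e) {u v : ℝ → E}
    (hu : IsRecurrentTrajectory f K u) (hv : IsRecurrentTrajectory f K v) {a b : ℝ} (ha : 0 ≤ a)
    (hb : 0 ≤ b) (hab : a + b = 1) : IsRecurrentTrajectory f K fun t => a • u t + b • v t := by
  refine ⟨hu.toIsProjTrajectory.convexCombination hf hKc hd hv.toIsProjTrajectory
    (fun t ht => hu.norm_sub_eq hf hd he hv ht) ha hb hab, fun ε hε T => ?_⟩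
  obtain ⟨t, hT, ht, h1, h2⟩ := hu.exists_simultaneous_return hf hd he hv hε T
  refine ⟨t, hT, ht, ?_⟩
  have h3 := (convex_ball (0 : E) ε) (x := u t - u 0) (by simpa using h1) (y := v t - v 0)
    (by simpa using h2) ha hb hab
  rw [mem_ball_zero_iff] at h3
  have e1 : a • u t + b • v t - (a • u 0 + b • v 0) =
      a • (u t - u 0) + b • (v t - v 0) := by module
  rwa [e1]

theorem convex_projOmega (hf : Continuous f) (hK : IsClosed K) (hKc : Convex ℝ K)
    (hd : DissipativeOn f K) (he : IsEquilibrium f K e) : Convex ℝ (projOmega f K) := by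
  intro p hp q hq a b ha hb hab
  obtain ⟨u, hu, rfl⟩ := exists_recurrentTrajectory hf hK hd he hp
  obtain ⟨v, hv, rfl⟩ := exists_recurrentTrajectory hf hK hd he hq
  exact (hu.convexCombination hf hKc hd he hv ha hb hab).mem_projOmega

theorem isClosed_projOmega (hf : Continuous f) (hK : IsClosed K)
    (hd : DissipativeOn f K) (he : IsEquilibrium f K e) : IsClosed (projOmega f K) := by
  refine isClosed_of_closure_subset fun p hp => ?_
  obtain ⟨x, hx, hlim⟩ := mem_closure_iff_seq_limit.1 hp
  choose z hz hz0 using fun k => exists_recurrentTrajectory hf hK hd he (hx k)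
  have hlim' : Tendsto (fun k => z k 0) atTop (𝓝 p) := by simpa only [hz0] using hlim
  obtain ⟨u, hu, rfl, -⟩ :=
    exists_limit_trajectory hf hK hd he (fun k => (hz k).toIsProjTrajectory) hlim'
  exact (IsRecurrentTrajectory.of_tendsto hd hz hu hlim').mem_projOmega

/-- Recurrent trajectories extend backwards in time. -/
theorem IsRecurrentTrajectory.exists_backward (hf : Continuous f) (hK : IsClosed K)
    (hd : DissipativeOn f K) (he : IsEquilibrium f K e) {u : ℝ → E}
    (hu : IsRecurrentTrajectory f K u) {a : ℝ} (ha : 0 ≤ a) :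
    ∃ v, IsRecurrentTrajectory f K v ∧ v a = u 0 := by
  choose s hs1 _ hs2 using fun k : ℕ => hu.recurrent (1 / ((k : ℝ) + 1)) (by positivity) a
  have hlim : Tendsto (fun k => u (s k)) atTop (𝓝 (u 0)) := by
    rw [tendsto_iff_dist_tendsto_zero]
    refine squeeze_zero (fun _ => dist_nonneg) (fun k => ?_)
      (tendsto_one_div_add_atTop_nhds_zero_nat (𝕜 := ℝ))
    rw [dist_eq_norm]
    exact (hs2 k).le
  -- These trajectories reach `u (s k)`, near `u 0`, at time `a`. Since distances are conserved,
  -- being Cauchy at time `a` implies being Cauchy at time `0`.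
  have hz : ∀ k, IsRecurrentTrajectory f K fun t => u (s k - a + t) := fun k =>
    hu.shift hf hd he (sub_nonneg.2 (hs1 k))
  have hc : CauchySeq fun k => u (s k - a + 0) := by
    rw [Metric.cauchySeq_iff]
    intro ε hε
    obtain ⟨N, hN⟩ := Metric.cauchySeq_iff.1 hlim.cauchySeq ε hε
    refine ⟨N, fun i hi j hj => ?_⟩
    have h1 := (hz i).norm_sub_eq hf hd he (hz j) ha
    rw [dist_eq_norm, ← h1]
    simpa only [sub_add_cancel, dist_eq_norm] using hN i hi j hj
  have := FiniteDimensional.complete ℝ E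
  obtain ⟨p, hp⟩ := cauchySeq_tendsto_of_complete hc
  obtain ⟨v, hv, rfl, hvt⟩ :=
    exists_limit_trajectory hf hK hd he (fun k => (hz k).toIsProjTrajectory) hp
  refine ⟨v, IsRecurrentTrajectory.of_tendsto hd hz hv hp, tendsto_nhds_unique (hvt a ha) ?_⟩
  simpa only [sub_add_cancel] using hlim

theorem IsProjTrajectory.eq_of_eq (hd : DissipativeOn f K) {u v : ℝ → E}
    (hu : IsProjTrajectory f K u) (hv : IsProjTrajectory f K v) (h : u 0 = v 0) {t : ℝ}
    (ht : 0 ≤ t) : u t = v t := by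
  have := hu.norm_sub_antitone hd hv le_rfl ht
  rw [h, sub_self, norm_zero] at this
  exact sub_eq_zero.1 (norm_le_zero_iff.1 this)

end Omega

/-! ### Extending semiflows of surjective isometries to flows -/

theorem exists_flow_of_semiflow {X : Type*} [MetricSpace X] (S : ℝ → X → X)
    (h0 : ∀ x, S 0 x = x) (hadd : ∀ a b, 0 ≤ a → 0 ≤ b → ∀ x, S (a + b) x = S a (S b x))
    (hiso : ∀ a, 0 ≤ a → Isometry (S a)) (hsurj : ∀ a, 0 ≤ a → Function.Surjective (S a))
    (hcont : ∀ x, ContinuousOn (fun t => S t x) (Ici 0)) :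
    ∃ Ψ : Flow ℝ X, (∀ t, Isometry (Ψ t)) ∧ ∀ t, 0 ≤ t → ∀ x, Ψ t x = S t x := by
  -- The value at `t = a - b` is to be `S b` inverted on `S a x`. Writing `x` as the image of `w`
  -- under the negative part of `t`, the image of `w` under the positive part works for all such
  -- `a`, `b`.
  have key : ∀ t x, ∃ y, ∀ a b, 0 ≤ a → 0 ≤ b → t = a - b → S b y = S a x := by
    intro t x
    obtain ⟨w, rfl⟩ := hsurj (max (-t) 0) (le_max_right _ _) x
    refine ⟨S (max t 0) w, fun a b ha hb hab => ?_⟩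
    rw [← hadd _ _ hb (le_max_right _ _), ← hadd _ _ ha (le_max_right _ _)]
    congr 1
    rcases le_total t 0 with h | h
    · rw [max_eq_left (neg_nonneg.2 h), max_eq_right h]; linarith
    · rw [max_eq_right (neg_nonpos.2 h), max_eq_left h]; linarith
  choose Φ hΦ using key
  have hdiff : ∀ t : ℝ, ∃ a b : ℝ, 0 ≤ a ∧ 0 ≤ b ∧ t = a - b := fun t =>
    ⟨max t 0, max (-t) 0, le_max_right _ _, le_max_right _ _, by
      rcases le_total t 0 with h | h
      · rw [max_eq_left (neg_nonneg.2 h), max_eq_right h]; ring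
      · rw [max_eq_right (neg_nonpos.2 h), max_eq_left h]; ring⟩
  have hpos : ∀ t, 0 ≤ t → ∀ x, Φ t x = S t x := fun t ht x => by
    rw [← h0 (Φ t x)]
    exact hΦ t x t 0 ht le_rfl (sub_zero t).symm
  have hisoΦ : ∀ t, Isometry (Φ t) := by
    intro t
    obtain ⟨a, b, ha, hb, hab⟩ := hdiff t
    refine Isometry.of_dist_eq fun x y => ?_
    rw [← (hiso b hb).dist_eq, hΦ t x a b ha hb hab, hΦ t y a b ha hb hab, (hiso a ha).dist_eq]
  have hcontΦ : ∀ x, Continuous fun t => Φ t x := by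
    intro x
    rw [continuous_iff_continuousAt]
    intro t₀
    have hN : 0 ≤ |t₀| + 1 := by positivity
    have ht₀ : 0 < t₀ + (|t₀| + 1) := by linarith [neg_abs_le t₀]
    have h1 : ContinuousAt (fun t => S (t + (|t₀| + 1)) x) t₀ := by
      have h2 : ContinuousAt (fun t => S t x) (t₀ + (|t₀| + 1)) :=
        (hcont x).continuousAt (Ici_mem_nhds ht₀)
      have h3 : ContinuousAt (fun t => t + (|t₀| + 1)) t₀ := by fun_prop
      exact ContinuousAt.comp (f := fun t => t + (|t₀| + 1)) h2 h3
    -- Applying the embedding `S (|t₀| + 1)` moves a neighbourhood of `t₀` to positive times, where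
    -- continuity is known.
    refine ((hiso _ hN).isEmbedding.continuousAt_iff).2 (h1.congr ?_)
    have : ∀ᶠ t in 𝓝 t₀, 0 < t + (|t₀| + 1) :=
      (by fun_prop : Continuous fun t : ℝ => t + (|t₀| + 1)).continuousAt.eventually
        (lt_mem_nhds ht₀)
    filter_upwards [this] with t ht
    exact (hΦ t x _ _ ht.le hN (by ring)).symm
  refine ⟨⟨Φ, ?_, fun t₁ t₂ x => ?_, fun x => ?_⟩, hisoΦ, hpos⟩
  · exact continuous_prod_of_continuous_lipschitzWith' _ 1 (fun t => (hisoΦ t).lipschitz) hcontΦ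
  · obtain ⟨a₁, b₁, ha₁, hb₁, h₁⟩ := hdiff t₁
    obtain ⟨a₂, b₂, ha₂, hb₂, h₂⟩ := hdiff t₂
    refine (hiso (b₂ + b₁) (add_nonneg hb₂ hb₁)).injective ?_
    rw [hΦ (t₁ + t₂) x (a₁ + a₂) (b₂ + b₁) (by positivity) (by positivity) (by linarith),
      hadd _ _ hb₂ hb₁, hΦ t₁ _ a₁ b₁ ha₁ hb₁ h₁, ← hadd _ _ hb₂ ha₁, add_comm b₂ a₁,
      hadd _ _ ha₁ hb₂, hΦ t₂ x a₂ b₂ ha₂ hb₂ h₂, ← hadd _ _ ha₁ ha₂]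
  · rw [hpos 0 le_rfl, h0]

theorem exists_flow_projOmega {E : Type*} [NormedAddCommGroup E] [InnerProductSpace ℝ E]
    [FiniteDimensional ℝ E] {f : E → E} {K : Set E} {e : E} (hf : Continuous f) (hK : IsClosed K)
    (hd : DissipativeOn f K) (he : IsEquilibrium f K e) :
    ∃ Ψ : Flow ℝ (projOmega f K), (∀ t, Isometry (Ψ t)) ∧
      ∀ p, IsRecurrentTrajectory f K fun t => (Ψ t p : E) := by
  choose U hU hU0 using fun p : projOmega f K => exists_recurrentTrajectory hf hK hd he p.2
  -- Trajectories are arbitrary at negative times, hence the truncation `max t 0`.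
  have hmem : ∀ p t, U p (max t 0) ∈ projOmega f K := fun p t => by
    have := ((hU p).shift hf hd he (le_max_right t 0)).mem_projOmega
    rwa [add_zero] at this
  have hadd : ∀ a b, 0 ≤ a → 0 ≤ b → ∀ p, (⟨U p (max (a + b) 0), hmem p (a + b)⟩ : projOmega f K) =
      ⟨U ⟨U p (max b 0), hmem p b⟩ (max a 0), hmem _ a⟩ := by
    refine fun a b ha hb p => Subtype.ext ?_
    simp only [max_eq_left ha, max_eq_left hb, max_eq_left (add_nonneg ha hb)]
    have h1 := ((hU p).shift hf hd he hb).toIsProjTrajectory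
    have h2 := (hU ⟨U p b, by simpa [max_eq_left hb] using hmem p b⟩).toIsProjTrajectory
    rw [add_comm]
    exact h1.eq_of_eq hd h2 (by simp [hU0]) ha
  have hiso : ∀ a, 0 ≤ a → Isometry fun p => (⟨U p (max a 0), hmem p a⟩ : projOmega f K) := by
    refine fun a _ => Isometry.of_dist_eq fun p q => ?_
    have h1 := (hU p).norm_sub_eq hf hd he (hU q) (le_max_right a 0)
    rwa [hU0, hU0, ← dist_eq_norm, ← dist_eq_norm] at h1
  have hsurj : ∀ a, 0 ≤ a →
      Function.Surjective fun p => (⟨U p (max a 0), hmem p a⟩ : projOmega f K) := by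
    intro a ha p
    obtain ⟨v, hv, hva⟩ := (hU p).exists_backward hf hK hd he ha
    refine ⟨⟨v 0, hv.mem_projOmega⟩, Subtype.ext ?_⟩
    simp only [max_eq_left ha]
    rw [(hU _).toIsProjTrajectory.eq_of_eq hd hv.toIsProjTrajectory (hU0 _) ha, hva, hU0]
  have hcont : ∀ p, ContinuousOn (fun t => (⟨U p (max t 0), hmem p t⟩ : projOmega f K))
      (Ici 0) := by
    intro p
    rw [Topology.IsInducing.subtypeVal.continuousOn_iff]
    refine (hU p).toIsProjTrajectory.continuousOn.congr fun t ht => ?_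
    simp only [Function.comp, max_eq_left (mem_Ici.1 ht)]
  obtain ⟨Ψ, hΨ, hΨS⟩ := exists_flow_of_semiflow (fun t p => ⟨U p (max t 0), hmem p t⟩)
    (fun p => Subtype.ext (by simp [hU0])) hadd hiso hsurj hcont
  refine ⟨Ψ, hΨ, fun p => (hU p).congr fun t ht => ?_⟩
  rw [hΨS t ht]
  simp only [max_eq_left ht]

section Faces

variable {E : Type*} [NormedAddCommGroup E] [InnerProductSpace ℝ E]

/-- Strict convexity of the norm, from the parallelogram law; it makes the point nearest to an
equilibrium unique, hence stationary. -/
theorem eq_of_norm_midpoint_ge {a b : E} (hab : ‖b‖ = ‖a‖)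
    (h : ‖a‖ ≤ ‖(1 / 2 : ℝ) • a + (1 / 2 : ℝ) • b‖) : b = a := by
  rw [← smul_add, norm_smul, Real.norm_of_nonneg (by norm_num)] at h
  have h1 := parallelogram_law_with_norm ℝ a b
  rw [hab] at h1
  have h2 : 2 * ‖a‖ ≤ ‖a + b‖ := by linarith
  have h3 : ‖a - b‖ * ‖a - b‖ ≤ 0 := by nlinarith [norm_nonneg a]
  have h4 : ‖a - b‖ = 0 := by nlinarith [norm_nonneg (a - b)]
  exact (sub_eq_zero.1 (norm_eq_zero.1 h4)).symm

/-! ### Faces -/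

theorem minimalFace_subset {K A : Set E} (hK : Convex ℝ K) (hA : A ⊆ K) : minimalFace K A ⊆ K :=
  sInter_subset_of_mem ⟨⟨hK, IsExtreme.rfl⟩, hA⟩

theorem mem_minimalFace_of_openSegment {K A : Set E} {m p q : E} (hm : m ∈ A) (hp : p ∈ K)
    (hq : q ∈ K) (h : m ∈ openSegment ℝ p q) : p ∈ minimalFace K A :=
  mem_sInter.2 fun _ hF => hF.1.2.left_mem_of_mem_openSegment hp hq (hF.2 hm) h

/-- A normal to `K` at `u` exposes a face of `K`. -/
theorem isFace_of_mem_normalCone {K : Set E} (hK : Convex ℝ K) {u n : E}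
    (hn : n ∈ normalCone K u) : IsFace K {q | q ∈ K ∧ inner ℝ n (q - u) = 0} := by
  have hlin : ∀ x y : E, ∀ a b : ℝ, a + b = 1 →
      inner ℝ n (a • x + b • y - u) = a * inner ℝ n (x - u) + b * inner ℝ n (y - u) := by
    intro x y a b hab
    have e1 : a • x + b • y - u = a • (x - u) + b • (y - u) := by
      obtain rfl : a = 1 - b := by linarith
      module
    rw [e1, inner_add_right, inner_smul_right, inner_smul_right]
  refine ⟨fun x hx y hy a b ha hb hab => ⟨hK hx.1 hy.1 ha hb hab, ?_⟩,
    ⟨fun q hq => hq.1, fun x hx y hy z hz hxy => ⟨hx, ?_⟩⟩⟩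
  · rw [hlin x y a b hab, hx.2, hy.2]; simp
  · obtain ⟨a, b, ha, hb, hab, rfl⟩ := hxy
    have h1 := hz.2
    rw [hlin x y a b hab] at h1
    have h2 := hn x hx
    have h3 := mul_nonpos_of_nonneg_of_nonpos hb.le (hn y hy)
    refine le_antisymm h2 ?_
    by_contra hlt
    have := mul_neg_of_pos_of_neg ha (not_le.1 hlt)
    linarith

theorem inner_eq_zero_of_mem_affineSpan {A : Set E} {u n : E}
    (h : ∀ q ∈ A, inner ℝ n (q - u) = 0) {w : E} (hw : w ∈ affineSpan ℝ A) :
    inner ℝ n (w - u) = 0 := by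
  refine affineSpan_induction hw h fun c x y z hx hy hz => ?_
  have e1 : (c • (x -ᵥ y) +ᵥ z) - u = c • ((x - u) - (y - u)) + (z - u) := by
    simp only [vsub_eq_sub, vadd_eq_add]
    module
  rw [e1, inner_add_right, inner_smul_right, inner_sub_right, hx, hy, hz]
  simp

/-! ### Relative interior -/

theorem exists_relative_ball [FiniteDimensional ℝ E] {C : Set E} (hC : Convex ℝ C)
    (hne : C.Nonempty) :
    ∃ c ∈ C, ∃ r > 0, ∀ x ∈ affineSpan ℝ C, dist x c < r → x ∈ C := by
  obtain ⟨c, hc⟩ := hne.intrinsicInterior hC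
  obtain ⟨y, hy, rfl⟩ := mem_intrinsicInterior.1 hc
  obtain ⟨r, hr, hball⟩ := Metric.mem_nhds_iff.1 (mem_interior_iff_mem_nhds.1 hy)
  exact ⟨y, intrinsicInterior_subset hc, r, hr, fun x hx hxr =>
    hball (show (⟨x, hx⟩ : affineSpan ℝ C) ∈ Metric.ball y r from hxr)⟩

/-! ### Projections to affine subspaces -/

/-- The normal cone to an affine subspace is the orthogonal complement of its direction. -/
theorem sub_proj_normalCone_affineSubspace [FiniteDimensional ℝ E] (V : AffineSubspace ℝ E)
    {z : E} (hz : z ∈ V) (v : E) :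
    v - proj (normalCone (V : Set E) z) v = V.direction.starProjection v := by
  have hP : V.direction.starProjection v ∈ V.direction := Submodule.starProjection_apply_mem _ _
  have hQ : v - V.direction.starProjection v ∈ V.directionᗮ :=
    Submodule.sub_starProjection_mem_orthogonal v
  have h : proj (normalCone (V : Set E) z) v = v - V.direction.starProjection v := by
    refine proj_eq_of_inner_le (fun w hw => ?_) fun q hq => ?_
    · rw [real_inner_comm]
      exact (hQ _ (AffineSubspace.vsub_mem_direction hw hz)).le
    · have h1 := hq (V.direction.starProjection v +ᵥ z)
        (AffineSubspace.vadd_mem_of_mem_direction hP hz)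
      simp only [vadd_eq_add, add_sub_cancel_right] at h1
      have h2 := hQ _ hP
      rw [sub_sub_cancel, inner_sub_right, h2, real_inner_comm]
      linarith
  rw [h, sub_sub_cancel]

/-! ### Recurrent trajectories lie in the minimal face of the equilibria -/

variable [FiniteDimensional ℝ E] {f : E → E} {K : Set E} {e : E}

theorem IsRecurrentTrajectory.norm_sub_equilibrium (hf : Continuous f) (hd : DissipativeOn f K)
    (he : IsEquilibrium f K e) {u : ℝ → E} (hu : IsRecurrentTrajectory f K u) {t : ℝ}
    (ht : 0 ≤ t) : ‖u t - e‖ = ‖u 0 - e‖ :=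
  hu.norm_sub_eq hf hd he (isRecurrentTrajectory_const he) ht

/-- The equation holds at some positive time, where the velocity is `0`, so `f m` equals its
projection to the normal cone. -/
theorem isEquilibrium_of_constant {m : E}
    (hm : IsProjTrajectory f K fun _ => m) : IsEquilibrium f K m := by
  refine ⟨hm.mem 0 le_rfl, ?_⟩
  have h1 := (ae_restrict_iff' measurableSet_Ioi).2 (hm.hasDerivAt.mono fun t h (ht : t ∈ Ioi 0) =>
    h ht)
  have : NeBot (ae (volume.restrict (Ioi (0 : ℝ)))) := by
    rw [ae_restrict_neBot]; simp
  obtain ⟨t, ht⟩ := h1.exists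
  have h2 := ht.unique (hasDerivAt_const t m)
  rw [sub_eq_zero.1 h2]
  exact (proj_normalCone_spec K m (f m)).1

/-- Every point of `Ω` is an end point of a segment in `K` through an equilibrium. -/
theorem exists_equilibrium_mem_openSegment (hf : Continuous f) (hK : IsClosed K)
    (hKc : Convex ℝ K) (hd : DissipativeOn f K) (he : IsEquilibrium f K e) {p : E}
    (hp : p ∈ projOmega f K) :
    ∃ m, IsEquilibrium f K m ∧ ∃ q ∈ K, m ∈ openSegment ℝ p q := by
  have := FiniteDimensional.proper ℝ E
  have hΩK : projOmega f K ⊆ K := fun x hx => by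
    obtain ⟨u, hu, rfl⟩ := exists_recurrentTrajectory hf hK hd he hx
    exact hu.mem 0 le_rfl
  set R := ‖p - e‖ with hR
  set Q := projOmega f K ∩ Metric.closedBall e R with hQ
  have hQconv : Convex ℝ Q := (convex_projOmega hf hK hKc hd he).inter (convex_closedBall e R)
  have hQclosed : IsClosed Q := (isClosed_projOmega hf hK hd he).inter Metric.isClosed_closedBall
  have hpQ : p ∈ Q := ⟨hp, by simp [dist_eq_norm, hR]⟩
  have hQinv : ∀ u, IsRecurrentTrajectory f K u → ∀ t, 0 ≤ t → (u t ∈ Q ↔ u 0 ∈ Q) := by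
    intro u hu t ht
    have h1 := (hu.shift hf hd he ht).mem_projOmega
    rw [add_zero] at h1
    simp only [hQ, mem_inter_iff, h1, hu.mem_projOmega, true_and, Metric.mem_closedBall,
      dist_eq_norm, hu.norm_sub_equilibrium hf hd he ht]
  obtain ⟨x₀, hx₀, r, hr, hball⟩ := exists_relative_ball hQconv ⟨p, hpQ⟩
  have hR0 : 0 ≤ R := norm_nonneg _
  -- Points of `Q` are at most `2 * R` apart, so prolonging a segment from `y` through `x₀` by the
  -- factor `c` stays in the relative ball. The `1` covers `R = 0`.
  set c := r / (2 * R + 1) with hc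
  have hc0 : 0 < c := by positivity
  set Qc := {x | x ∈ Q ∧ ∀ y ∈ Q, x + c • (x - y) ∈ Q} with hQc
  have hx₀c : x₀ ∈ Qc := by
    refine ⟨hx₀, fun y hy => hball _ ?_ ?_⟩
    · have := AffineMap.lineMap_mem (-c) (subset_affineSpan ℝ Q hx₀) (subset_affineSpan ℝ Q hy)
      rw [AffineMap.lineMap_apply_module'] at this
      convert this using 1
      module
    · rw [dist_eq_norm, add_sub_cancel_left, norm_smul, Real.norm_of_nonneg hc0.le]
      have h1 : ‖x₀ - y‖ ≤ 2 * R := by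
        have h2 := hx₀.2
        have h3 := hy.2
        rw [Metric.mem_closedBall] at h2 h3
        rw [← dist_eq_norm]
        have := dist_triangle_right x₀ y e
        linarith
      calc c * ‖x₀ - y‖ ≤ c * (2 * R) := by gcongr
        _ < c * (2 * R + 1) := by gcongr; linarith
        _ = r := by rw [hc]; field_simp
  have hQcconv : Convex ℝ Qc := by
    intro x hx x' hx' a b ha hb hab
    refine ⟨hQconv hx.1 hx'.1 ha hb hab, fun y hy => ?_⟩
    have h1 := hQconv (hx.2 y hy) (hx'.2 y hy) ha hb hab
    convert h1 using 1
    obtain rfl : a = 1 - b := by linarith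
    module
  have hQcclosed : IsClosed Qc := by
    have : Qc = Q ∩ ⋂ y ∈ Q, (fun x => x + c • (x - y)) ⁻¹' Q := by
      ext x; simp [hQc]
    rw [this]
    exact hQclosed.inter (isClosed_biInter fun y _ => hQclosed.preimage (by fun_prop))
  -- The flow is affine: pull `y` back to `v 0`, prolong to `w 0` in `Q`, and write `u 0` as a
  -- convex combination of `w 0` and `v 0`. The same combination holds at time `t`, so `w t`
  -- prolongs the segment from `y` through `u t`.
  have hQcinv : ∀ u, IsRecurrentTrajectory f K u → u 0 ∈ Qc → ∀ t, 0 ≤ t → u t ∈ Qc := by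
    intro u hu hu0 t ht
    refine ⟨(hQinv u hu t ht).2 hu0.1, fun y hy => ?_⟩
    obtain ⟨y', hy', hy'0⟩ := exists_recurrentTrajectory hf hK hd he hy.1
    obtain ⟨v, hv, hvt⟩ := hy'.exists_backward hf hK hd he ht
    rw [hy'0] at hvt
    have hv0 : v 0 ∈ Q := (hQinv v hv t ht).1 (hvt ▸ hy)
    have hw0 := hu0.2 _ hv0
    obtain ⟨w, hw, hw0'⟩ := exists_recurrentTrajectory hf hK hd he hw0.1
    have hab : 1 / (1 + c) + c / (1 + c) = 1 := by field_simp
    have hcomb := hw.convexCombination hf hKc hd he hv (a := 1 / (1 + c)) (b := c / (1 + c))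
      (by positivity) (by positivity) hab
    have heq := hu.toIsProjTrajectory.eq_of_eq hd hcomb.toIsProjTrajectory (by
      rw [hw0']
      match_scalars <;> field_simp
      ring) ht
    have hwt : u t + c • (u t - y) = w t := by
      rw [heq, hvt]
      match_scalars <;> field_simp
      ring
    rw [hwt]
    exact (hQinv w hw t ht).2 (hw0'.symm ▸ hw0)
  -- The point of `Qc` nearest to `e` is fixed, since `Qc` is invariant and the distance to `e` is
  -- conserved.
  obtain ⟨m, hm, hmin⟩ := hQcclosed.exists_infDist_eq_dist ⟨x₀, hx₀c⟩ e
  have hmin' : ∀ x ∈ Qc, ‖m - e‖ ≤ ‖x - e‖ := fun x hx => by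
    rw [← dist_eq_norm, ← dist_eq_norm, dist_comm, dist_comm x, ← hmin]
    exact Metric.infDist_le_dist_of_mem hx
  obtain ⟨u, hu, hu0⟩ := exists_recurrentTrajectory hf hK hd he hm.1.1
  have hconst : ∀ t, 0 ≤ t → m = u t := by
    intro t ht
    have h1 := hu.norm_sub_equilibrium hf hd he ht
    rw [hu0] at h1
    have h2 := hQcconv hm (hQcinv u hu (hu0.symm ▸ hm) t ht) (a := 1 / 2) (b := 1 / 2)
      (by norm_num) (by norm_num) (by norm_num)
    have h3 := hmin' _ h2
    have e1 : (1 / 2 : ℝ) • m + (1 / 2 : ℝ) • u t - e =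
        (1 / 2 : ℝ) • (m - e) + (1 / 2 : ℝ) • (u t - e) := by module
    rw [e1] at h3
    have := eq_of_norm_midpoint_ge h1 h3
    exact (sub_left_inj.1 this).symm
  have hmeq : IsEquilibrium f K m :=
    isEquilibrium_of_constant (hu.congr hconst).toIsProjTrajectory
  refine ⟨m, hmeq, m + c • (m - p), hΩK (hm.2 p hpQ).1, c / (1 + c), 1 / (1 + c), by positivity,
    by positivity, by field_simp; ring, ?_⟩
  match_scalars <;> field_simp
  ring

theorem projOmega_subset_minimalFace (hf : Continuous f) (hK : IsClosed K)
    (hKc : Convex ℝ K) (hd : DissipativeOn f K) (he : IsEquilibrium f K e) :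
    projOmega f K ⊆ minimalFace K {z | IsEquilibrium f K z} := by
  intro p hp
  obtain ⟨m, hm, q, hq, h⟩ := exists_equilibrium_mem_openSegment hf hK hKc hd he hp
  obtain ⟨u, hu, rfl⟩ := exists_recurrentTrajectory hf hK hd he hp
  exact mem_minimalFace_of_openSegment hm (hu.mem 0 le_rfl) hq h

theorem IsRecurrentTrajectory.mem_affineSpan (hf : Continuous f) (hK : IsClosed K)
    (hKc : Convex ℝ K) (hd : DissipativeOn f K) (he : IsEquilibrium f K e) {u : ℝ → E}
    (hu : IsRecurrentTrajectory f K u) {t : ℝ} (ht : 0 ≤ t) :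
    u t ∈ affineSpan ℝ (minimalFace K {z | IsEquilibrium f K z}) := by
  have h1 := (hu.shift hf hd he ht).mem_projOmega
  rw [add_zero] at h1
  exact subset_affineSpan ℝ _ (projOmega_subset_minimalFace hf hK hKc hd he h1)

/-- Recurrent trajectories follow the field projected to the span of the minimal face. -/
theorem IsRecurrentTrajectory.ae_hasDerivAt_starProjection (hf : Continuous f) (hK : IsClosed K)
    (hKc : Convex ℝ K) (hd : DissipativeOn f K) (he : IsEquilibrium f K e) {u : ℝ → E}
    (hu : IsRecurrentTrajectory f K u) :
    ∀ᵐ t ∂(volume : Measure ℝ), 0 < t → HasDerivAt u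
      ((affineSpan ℝ (minimalFace K {z | IsEquilibrium f K z})).direction.starProjection
        (f (u t))) t := by
  filter_upwards [hu.hasDerivAt] with t h ht
  specialize h ht
  set V := affineSpan ℝ (minimalFace K {z | IsEquilibrium f K z}) with hV
  have hmem : ∀ s, 0 ≤ s → u s ∈ (V : Set E) := fun s hs =>
    hu.mem_affineSpan hf hK hKc hd he hs
  have hn := (proj_normalCone_spec K (u t) (f (u t))).1
  -- The distance to each equilibrium is constant, so the normal part of the velocity exposes a face
  -- containing all equilibria.
  have hface : minimalFace K {z | IsEquilibrium f K z} ⊆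
      {q | q ∈ K ∧ inner ℝ (proj (normalCone K (u t)) (f (u t))) (q - u t) = 0} := by
    refine sInter_subset_of_mem ⟨isFace_of_mem_normalCone hKc hn, fun z hz => ⟨hz.1, ?_⟩⟩
    have h2 := (hu.toIsProjTrajectory.inner_eq_zero hd (isProjTrajectory_const hz.1 hz.2)
      (fun s hs => hu.norm_sub_equilibrium hf hd hz hs) ht h (by
        rw [proj_eq_self hz.2, sub_self]; exact hasDerivAt_const t z)).2.1
    rw [← neg_sub, inner_neg_right, h2, neg_zero]
  have hnV : f (u t) - (f (u t) - proj (normalCone K (u t)) (f (u t))) ∈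
      normalCone (V : Set E) (u t) := by
    intro w hw
    rw [sub_sub_cancel]
    exact (inner_eq_zero_of_mem_affineSpan (fun q hq => (hface hq).2) hw).le
  have h3 := eq_sub_proj_of_hasDerivAt h (eventually_mem_of_pos hmem ht) hnV
  rw [sub_proj_normalCone_affineSubspace V (hmem t ht.le)] at h3
  exact h3 ▸ h

/-- Absolutely continuous solutions of equations with continuous right hand sides are classical. -/
theorem hasDerivAt_of_ae_hasDerivAt {u g : ℝ → E} (hu : ∀ T, 0 ≤ T →
    AbsolutelyContinuousOnInterval u 0 T) (hg : ContinuousOn g (Ici 0))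
    (hd : ∀ᵐ t ∂(volume : Measure ℝ), 0 < t → HasDerivAt u (g t) t) {t : ℝ} (ht : 0 < t) :
    HasDerivAt u (g t) t := by
  have hint : ∀ s, 0 ≤ s → IntervalIntegrable g volume 0 s := fun s hs =>
    ContinuousOn.intervalIntegrable (hg.mono (by rw [uIcc_of_le hs]; exact Icc_subset_Ici_self))
  have := FiniteDimensional.complete ℝ E
  have hI : ∀ s, 0 < s → HasDerivAt (fun x => ∫ r in (0 : ℝ)..x, g r) (g s) s := fun s hs =>
    intervalIntegral.integral_hasDerivAt_right (hint s hs.le)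
      ((hg.mono Ioi_subset_Ici_self).stronglyMeasurableAtFilter isOpen_Ioi s hs)
      (hg.continuousAt (Ici_mem_nhds hs))
  have hT : (0 : ℝ) ≤ t + 1 := by linarith
  have hJ : AbsolutelyContinuousOnInterval (fun x => ∫ r in (0 : ℝ)..x, g r) 0 (t + 1) := by
    obtain ⟨M, hM⟩ := (isCompact_Icc (a := (0 : ℝ)) (b := t + 1)).exists_bound_of_continuousOn
      (hg.mono Icc_subset_Ici_self)
    refine LipschitzOnWith.absolutelyContinuousOnInterval (K := M.toNNReal)
      (LipschitzOnWith.of_dist_le_mul fun x hx y hy => ?_)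
    rw [uIcc_of_le hT] at hx hy
    rw [dist_eq_norm, intervalIntegral.integral_interval_sub_left (hint x hx.1) (hint y hy.1),
      Real.dist_eq]
    refine intervalIntegral.norm_integral_le_of_norm_le_const fun r hr => ?_
    have hr' := uIcc_subset_Icc hy hx (uIoc_subset_uIcc hr)
    exact (hM r hr').trans (Real.le_coe_toNNReal M)
  have hac : AbsolutelyContinuousOnInterval (fun x => u x - ∫ r in (0 : ℝ)..x, g r) 0 (t + 1) :=
    (hu _ hT).fun_sub hJ
  have hzero : ∀ᵐ s ∂(volume : Measure ℝ), s ∈ uIcc 0 (t + 1) →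
      HasDerivAt (fun x => u x - ∫ r in (0 : ℝ)..x, g r) 0 s := by
    have h0 : ∀ᵐ s ∂(volume : Measure ℝ), s ≠ 0 := by simp [ae_iff, measure_singleton]
    filter_upwards [hd, h0] with s hs hs0 hmem
    rw [uIcc_of_le hT] at hmem
    have hpos : 0 < s := lt_of_le_of_ne hmem.1 (Ne.symm hs0)
    have := (hs hpos).fun_sub (hI s hpos)
    rwa [sub_self] at this
  obtain ⟨C, hC⟩ := hac.const_of_ae_hasDerivAt_zero hzero
  refine ((hI t ht).const_add C).congr_of_eventuallyEq ?_
  filter_upwards [Ioo_mem_nhds ht (lt_add_one t)] with s hs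
  have := hC s (by rw [uIcc_of_le hT]; exact Ioo_subset_Icc_self hs)
  rw [← this]
  abel

theorem IsRecurrentTrajectory.hasDerivAt_starProjection (hf : Continuous f) (hK : IsClosed K)
    (hKc : Convex ℝ K) (hd : DissipativeOn f K) (he : IsEquilibrium f K e) {u : ℝ → E}
    (hu : IsRecurrentTrajectory f K u) {t : ℝ} (ht : 0 < t) :
    HasDerivAt u ((affineSpan ℝ (minimalFace K {z | IsEquilibrium f K z})).direction.starProjection
      (f (u t))) t := by
  refine hasDerivAt_of_ae_hasDerivAt (g := fun t =>
    (affineSpan ℝ (minimalFace K {z | IsEquilibrium f K z})).direction.starProjection (f (u t)))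
    hu.absolutelyContinuous ?_ (hu.ae_hasDerivAt_starProjection hf hK hKc hd he) ht
  exact (ContinuousLinearMap.continuous _).comp_continuousOn
    (hf.comp_continuousOn hu.toIsProjTrajectory.continuousOn)

end Faces

/-! ### Dissipativity of the gradient field of a concave-convex function -/

/-- A field that is dissipative at small distances in a convex set is dissipative there. -/
theorem dissipativeOn_of_local {E : Type*} [NormedAddCommGroup E] [InnerProductSpace ℝ E]
    {f : E → E} {P : Set E} (hP : Convex ℝ P) {δ : ℝ} (hδ : 0 < δ)
    (h : ∀ a ∈ P, ∀ b ∈ P, dist a b < δ → inner ℝ (f a - f b) (a - b) ≤ 0) :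
    DissipativeOn f P := by
  intro z hz w hw
  obtain ⟨N, hN⟩ := exists_nat_gt (‖z - w‖ / δ)
  have hN0 : (0 : ℝ) < N := (div_nonneg (norm_nonneg _) hδ.le).trans_lt hN
  have hmem : ∀ i : ℕ, i ≤ N → w + ((i : ℝ) / N) • (z - w) ∈ P := fun i hi =>
    hP.add_smul_sub_mem hw hz ⟨by positivity, div_le_one_of_le₀ (by exact_mod_cast hi) hN0.le⟩
  -- The inequality telescopes over `N` equal steps shorter than `δ`.
  have key : ∀ i : ℕ, i ≤ N → inner ℝ (f (w + ((i : ℝ) / N) • (z - w)) - f w) (z - w) ≤ 0 := by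
    intro i
    induction i with
    | zero => simp
    | succ i ih =>
      intro hi
      have h1 := ih (by omega)
      have e1 : w + (((i + 1 : ℕ) : ℝ) / N) • (z - w) - (w + ((i : ℝ) / N) • (z - w)) =
          (1 / (N : ℝ)) • (z - w) := by
        push_cast
        rw [add_div]
        module
      have h2 := h _ (hmem (i + 1) hi) _ (hmem i (by omega)) (by
        rw [dist_eq_norm, e1, norm_smul, Real.norm_of_nonneg (by positivity), one_div,
          inv_mul_lt_iff₀ hN0]
        rwa [div_lt_iff₀ hδ] at hN)
      rw [e1, inner_smul_right] at h2
      have h3 := nonpos_of_mul_nonpos_right h2 (by positivity)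
      rw [inner_sub_left] at h1 h3 ⊢
      linarith
  have := key N le_rfl
  rwa [div_self hN0.ne', one_smul, add_sub_cancel] at this

section Gradient

variable {n m : ℕ} {φ : Pt n m → ℝ} {C : Set (Pt n m)}

theorem ConcaveConvexOn.le_fderiv_x (hφ : Differentiable ℝ φ) (hC : ConcaveConvexOn C φ)
    {z w : Pt n m} (hz : z ∈ C) (hw : pt (xPart w) (yPart z) ∈ C) :
    φ (pt (xPart w) (yPart z)) - φ z ≤ fderiv ℝ φ z (pt (xPart w) (yPart z) - z) := by
  refine fderiv_nonneg_of_segment (hφ z) fun s hs => ?_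
  have := (hC.1 (yPart z)).2 (x := xPart z) (by simpa [pt_parts] using hz) hw
    (sub_nonneg.2 hs.2) hs.1 (by ring)
  rw [segment_x]
  simp only [pt_parts, smul_eq_mul] at this
  linarith

theorem ConcaveConvexOn.fderiv_y_le (hφ : Differentiable ℝ φ) (hC : ConcaveConvexOn C φ)
    {z w : Pt n m} (hz : z ∈ C) (hw : pt (xPart z) (yPart w) ∈ C) :
    fderiv ℝ φ z (pt (xPart z) (yPart w) - z) ≤ φ (pt (xPart z) (yPart w)) - φ z := by
  have h2 : -(φ (pt (xPart z) (yPart w)) - φ z) ≤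
      fderiv ℝ (-φ) z (pt (xPart z) (yPart w) - z) := by
    refine fderiv_nonneg_of_segment (hφ z).neg fun s hs => ?_
    have := (hC.2 (xPart z)).2 (x := yPart z) (by simpa [pt_parts] using hz) hw
      (sub_nonneg.2 hs.2) hs.1 (by ring)
    rw [segment_y]
    simp only [pt_parts, smul_eq_mul] at this
    simp only [Pi.neg_apply]
    linarith
  rw [fderiv_neg] at h2
  simp only [neg_apply] at h2
  linarith

/-- Add the four first order inequalities along the sides of the rectangle with opposite corners `a`
and `b`; the values of `φ` cancel. -/
theorem ConcaveConvexOn.inner_gradField_le (hφ : Differentiable ℝ φ) (hC : ConcaveConvexOn C φ)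
    {a b : Pt n m} (ha : a ∈ C) (hb : b ∈ C) (hba : pt (xPart b) (yPart a) ∈ C)
    (hab : pt (xPart a) (yPart b) ∈ C) :
    inner ℝ (gradField φ a - gradField φ b) (a - b) ≤ 0 := by
  have h1 := inner_gradField φ a b
  have h2 := inner_gradField φ b a
  have h3 := hC.le_fderiv_x hφ ha hba
  have h4 := hC.le_fderiv_x hφ hb hab
  have h5 := hC.fderiv_y_le hφ ha hab
  have h6 := hC.fderiv_y_le hφ hb hba
  rw [← neg_sub a b, inner_neg_right] at h1
  rw [inner_sub_left]
  linarith

theorem norm_sq_eq_parts (z : Pt n m) : ‖z‖ ^ 2 = ‖xPart z‖ ^ 2 + ‖yPart z‖ ^ 2 := by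
  simp [EuclideanSpace.norm_sq_eq, xPart, yPart]

theorem dist_pt_le_left (a b : Pt n m) : dist (pt (xPart b) (yPart a)) a ≤ dist a b := by
  rw [dist_comm a b, dist_eq_norm, dist_eq_norm]
  refine le_of_sq_le_sq ?_ (norm_nonneg _)
  rw [norm_sq_eq_parts, norm_sq_eq_parts (b - a)]
  have h1 : xPart (pt (xPart b) (yPart a) - a) = xPart (b - a) := rfl
  have h2 : yPart (pt (xPart b) (yPart a) - a) = 0 := by
    ext i; exact sub_self (a (Sum.inr i))
  rw [h1, h2, norm_zero]
  nlinarith [sq_nonneg ‖yPart (b - a)‖]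

theorem HasProductSpan.pt_mem (hspan : HasProductSpan C) {a b : Pt n m}
    (ha : a ∈ affineSpan ℝ C) (hb : b ∈ affineSpan ℝ C) :
    pt (xPart a) (yPart b) ∈ affineSpan ℝ C := by
  obtain ⟨A, B, h⟩ := hspan
  exact (h _).2 ⟨((h a).1 ha).1, ((h b).1 hb).2⟩

/-- The corners of the rectangle on two points of `C` may lie outside `C`. After contracting `C` by
`1 - ε` towards a relatively interior point, points closer than `ε * r` have their corners in `C`,
as the span is a product. Local dissipativity suffices, and then `ε → 0`. -/
theorem dissipativeOn_gradField (hφ : Differentiable ℝ φ) (hf : Continuous (gradField φ))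
    (hC : Convex ℝ C) (hspan : HasProductSpan C) (hφC : ConcaveConvexOn C φ) :
    DissipativeOn (gradField φ) C := by
  intro z hz w hw
  obtain ⟨c, hc, r, hr, hball⟩ := exists_relative_ball hC ⟨z, hz⟩
  have key : ∀ ε ∈ Ioo (0 : ℝ) 1, inner ℝ
      (gradField φ ((1 - ε) • z + ε • c) - gradField φ ((1 - ε) • w + ε • c))
      (((1 - ε) • z + ε • c) - ((1 - ε) • w + ε • c)) ≤ 0 := by
    intro ε hε
    have hε1 : 0 ≤ 1 - ε := by linarith [hε.2]
    have hsub : ∀ x ∈ C, ∀ q ∈ affineSpan ℝ C, dist q ((1 - ε) • x + ε • c) < ε * r → q ∈ C := by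
      intro x hx q hq hqd
      have hxm : (1 - ε) • x + ε • c ∈ affineSpan ℝ C :=
        subset_affineSpan ℝ C (hC hx hc hε1 hε.1.le (by ring))
      have h1 : c + ε⁻¹ • (q - ((1 - ε) • x + ε • c)) ∈ C := by
        refine hball _ ?_ ?_
        · have := AffineSubspace.smul_vsub_vadd_mem _ ε⁻¹ hq hxm (subset_affineSpan ℝ C hc)
          rwa [vsub_eq_sub, vadd_eq_add, add_comm] at this
        · rw [dist_eq_norm, add_sub_cancel_left, norm_smul, Real.norm_of_nonneg
            (inv_nonneg.2 hε.1.le), inv_mul_lt_iff₀ hε.1, ← dist_eq_norm]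
          exact hqd
      have h2 := hC hx h1 hε1 hε.1.le (by ring)
      rw [smul_add, smul_inv_smul₀ hε.1.ne'] at h2
      convert h2 using 1
      abel
    have hP : Convex ℝ ((fun x => (1 - ε) • x + ε • c) '' C) := by
      rintro _ ⟨x, hx, rfl⟩ _ ⟨y, hy, rfl⟩ a b ha hb hab
      refine ⟨a • x + b • y, hC hx hy ha hb hab, ?_⟩
      obtain rfl : a = 1 - b := by linarith
      module
    refine dissipativeOn_of_local hP (mul_pos hε.1 hr) ?_ _ ⟨z, hz, rfl⟩ _ ⟨w, hw, rfl⟩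
    rintro _ ⟨x, hx, rfl⟩ _ ⟨y, hy, rfl⟩ hd
    have hxC : (1 - ε) • x + ε • c ∈ C := hC hx hc hε1 hε.1.le (by ring)
    have hyC : (1 - ε) • y + ε • c ∈ C := hC hy hc hε1 hε.1.le (by ring)
    simp only at hd ⊢
    have hxs := subset_affineSpan ℝ C hxC
    have hys := subset_affineSpan ℝ C hyC
    refine hφC.inner_gradField_le hφ hxC hyC ?_ ?_
    · exact hsub x hx _ (hspan.pt_mem hys hxs) ((dist_pt_le_left _ _).trans_lt hd)
    · refine hsub y hy _ (hspan.pt_mem hxs hys) ((dist_pt_le_left _ _).trans_lt ?_)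
      rwa [dist_comm]
  have hcont : Continuous fun ε : ℝ => inner ℝ
      (gradField φ ((1 - ε) • z + ε • c) - gradField φ ((1 - ε) • w + ε • c))
      (((1 - ε) • z + ε • c) - ((1 - ε) • w + ε • c)) := by fun_prop
  have hlim := (hcont.tendsto 0).mono_left (nhdsWithin_le_nhds (s := Ioi 0))
  simp only [sub_zero, one_smul, zero_smul, add_zero] at hlim
  refine le_of_tendsto hlim ?_
  filter_upwards [Ioo_mem_nhdsGT (zero_lt_one' ℝ)] with ε hε using key ε hε

theorem contDiff_gradField (hφ : ContDiff ℝ 2 φ) : ContDiff ℝ 1 (gradField φ) := by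
  let J : Pt n m →ₗ[ℝ] Pt n m :=
    { toFun := fun g => pt (xPart g) (-yPart g)
      map_add' := fun g h => by
        ext i
        rcases i with i | i
        · rfl
        · exact neg_add (g (Sum.inr i)) (h (Sum.inr i))
      map_smul' := fun c g => by
        ext i
        rcases i with i | i
        · rfl
        · exact (smul_neg c (g (Sum.inr i))).symm }
  have h1 : ContDiff ℝ 1 (fderiv ℝ φ) := hφ.fderiv_right (by norm_num)
  have h2 : ContDiff ℝ 1 (gradient φ) :=
    (InnerProductSpace.toDual ℝ (Pt n m)).symm.contDiff.comp h1
  exact J.toContinuousLinearMap.contDiff.comp h2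

theorem ConcaveConvexOn.mono {K : Set (Pt n m)} (hφC : ConcaveConvexOn C φ) (hKC : K ⊆ C)
    (hK : Convex ℝ K) : ConcaveConvexOn K φ := by
  refine ⟨fun y => (hφC.1 y).subset (fun x hx => hKC hx) ?_,
    fun x => (hφC.2 x).subset (fun y hy => hKC hy) ?_⟩
  · intro x hx x' hx' a b ha hb hab
    have h1 := hK hx hx' ha hb hab
    have e1 : a • pt x y + b • pt x' y = pt (a • x + b • x') y := by
      ext i
      rcases i with i | i
      · rfl
      · change a * y i + b * y i = y i
        rw [← add_mul, hab, one_mul]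
    rwa [e1] at h1
  · intro y hy y' hy' a b ha hb hab
    have h1 := hK hy hy' ha hb hab
    have e1 : a • pt x y + b • pt x y' = pt x (a • y + b • y') := by
      ext i
      rcases i with i | i
      · change a * x i + b * x i = x i
        rw [← add_mul, hab, one_mul]
      · rfl
    rwa [e1] at h1

end Gradient

section Interior

variable {E : Type*} [NormedAddCommGroup E] [InnerProductSpace ℝ E]
  {f : E → E} {K : Set E} {e : E}

/-! ### Equilibria in the interior -/

theorem exists_pos_add_smul_mem (he : e ∈ interior K) (v : E) : ∃ c > (0 : ℝ), e + c • v ∈ K := by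
  have hc : Continuous fun c : ℝ => e + c • v := by fun_prop
  have h1 : ∀ᶠ c : ℝ in 𝓝 0, e + c • v ∈ K :=
    hc.continuousAt.eventually_mem (by simpa using mem_interior_iff_mem_nhds.1 he)
  obtain ⟨c, hcK, hc0⟩ :=
    ((h1.filter_mono (nhdsWithin_le_nhds (s := Ioi 0))).and self_mem_nhdsWithin).exists
  exact ⟨c, hc0, hcK⟩

theorem eq_zero_of_mem_normalCone_interior (he : e ∈ interior K) {v : E}
    (hv : v ∈ normalCone K e) : v = 0 := by
  obtain ⟨c, hc, hcK⟩ := exists_pos_add_smul_mem he v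
  have h1 := hv _ hcK
  rw [add_sub_cancel_left, inner_smul_right] at h1
  have h2 := nonpos_of_mul_nonpos_right h1 hc
  rw [real_inner_self_eq_norm_sq] at h2
  exact norm_eq_zero.1 (pow_eq_zero_iff two_ne_zero |>.1 (le_antisymm h2 (sq_nonneg _)))

/-- From any `p` in `K` the segment to the interior point `e` can be prolonged within `K`, so every
face containing `e` contains `p`. -/
theorem minimalFace_eq_of_mem_interior {A : Set E} (hK : Convex ℝ K) (hA : A ⊆ K) (heA : e ∈ A)
    (he : e ∈ interior K) : minimalFace K A = K := by
  refine (minimalFace_subset hK hA).antisymm fun p hp => ?_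
  obtain ⟨c, hc, hcK⟩ := exists_pos_add_smul_mem he (e - p)
  refine mem_minimalFace_of_openSegment heA hp hcK
    ⟨c / (1 + c), 1 / (1 + c), by positivity, by positivity, by field_simp; ring, ?_⟩
  match_scalars <;> field_simp
  ring

theorem inner_fderiv_nonpos (hd : DissipativeOn f K) {L : E →L[ℝ] E} (hL : HasFDerivAt f L e)
    (he : e ∈ interior K) (v : E) : inner ℝ (L v) v ≤ 0 := by
  have h1 : HasDerivAt (fun s : ℝ => f (e + s • v)) (L v) 0 := by
    have h2 : HasDerivAt (fun s : ℝ => e + s • v) v 0 := by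
      simpa using ((hasDerivAt_id (0 : ℝ)).smul_const v).const_add e
    exact HasFDerivAt.comp_hasDerivAt (f := fun s : ℝ => e + s • v) 0 (by simpa using hL) h2
  have h3 := h1.tendsto_slope_zero_right.inner (𝕜 := ℝ) (tendsto_const_nhds (x := v))
  refine le_of_tendsto h3 ?_
  have hc : Continuous fun s : ℝ => e + s • v := by fun_prop
  have h4 : ∀ᶠ s : ℝ in 𝓝 0, e + s • v ∈ K :=
    hc.continuousAt.eventually_mem (by simpa using mem_interior_iff_mem_nhds.1 he)
  filter_upwards [h4.filter_mono nhdsWithin_le_nhds, self_mem_nhdsWithin] with s hs hs0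
  have hs0' : (0 : ℝ) < s := hs0
  have h5 := hd _ hs _ (interior_subset he)
  rw [add_sub_cancel_left, inner_smul_right] at h5
  have h6 := nonpos_of_mul_nonpos_right h5 hs0'
  rw [zero_add, zero_smul, add_zero, real_inner_smul_left]
  exact mul_nonpos_of_nonneg_of_nonpos (inv_nonneg.2 hs0'.le) h6

/-- A dissipative field that conserves the distance of `z` to an interior equilibrium `e` to first
order agrees at `z` with its linearization at `e`. -/
theorem eq_fderiv_of_inner_eq_zero (hf : Continuous f) (hKc : Convex ℝ K)
    (hd : DissipativeOn f K) {L : E →L[ℝ] E} (hL : HasFDerivAt f L e) (he : e ∈ interior K)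
    (hfe : f e = 0) {z : E} (hz : z ∈ K) (h0 : inner ℝ (f z) (z - e) = 0) :
    f z = L (z - e) := by
  -- On the open segment `f` is affine up to normals, and normals at interior points vanish.
  -- Differentiating at `s = 0` then yields `L`.
  have hlin : ∀ s ∈ Ioo (0 : ℝ) 1, f (e + s • (z - e)) = s • f z := by
    intro s hs
    have h1 := sub_mem_normalCone_of_inner_eq_zero hf hKc hd hz (interior_subset he)
      (by rwa [hfe, sub_zero]) hs.1.le (sub_nonneg.2 hs.2.le) (by ring : s + (1 - s) = 1)
    have h2 : s • z + (1 - s) • e ∈ interior K :=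
      hKc.combo_self_interior_mem_interior hz he hs.1.le (sub_pos.2 hs.2) (by ring)
    have h3 := eq_zero_of_mem_normalCone_interior h2 h1
    rw [hfe, smul_zero, add_zero] at h3
    rw [← sub_eq_zero.1 h3]
    congr 1
    module
  have h1 : HasDerivAt (fun s : ℝ => f (e + s • (z - e))) (L (z - e)) 0 := by
    have h2 : HasDerivAt (fun s : ℝ => e + s • (z - e)) (z - e) 0 := by
      simpa using ((hasDerivAt_id (0 : ℝ)).smul_const (z - e)).const_add e
    exact HasFDerivAt.comp_hasDerivAt (f := fun s : ℝ => e + s • (z - e)) 0 (by simpa using hL) h2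
  refine tendsto_nhds_unique (tendsto_const_nhds.congr' ?_) h1.tendsto_slope_zero_right
  filter_upwards [Ioo_mem_nhdsGT (zero_lt_one' ℝ)] with s hs
  rw [zero_add, hlin s hs, zero_smul, add_zero, hfe, sub_zero, smul_smul,
    inv_mul_cancel₀ hs.1.ne', one_smul]

/-- Solutions in `K` of the equation `ż = f(z)` are trajectories. -/
theorem isProjTrajectory_of_hasDerivAt (hf : Continuous f) {z : ℝ → E}
    (hz : ∀ t, HasDerivAt z (f (z t)) t) (hzK : ∀ t, z t ∈ K) : IsProjTrajectory f K z := by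
  have hcont : Continuous z := continuous_iff_continuousAt.2 fun t => (hz t).continuousAt
  refine ⟨fun t _ => hzK t, fun T _ => ?_, .of_forall fun t _ => ?_⟩
  · refine ContDiffOn.absolutelyContinuousOnInterval (ContDiff.contDiffOn ?_)
    rw [contDiff_one_iff_deriv]
    refine ⟨fun t => (hz t).differentiableAt, ?_⟩
    have : deriv z = fun t => f (z t) := funext fun t => (hz t).deriv
    rw [this]
    exact hf.comp hcont
  · rw [← eq_sub_proj_of_hasDerivAt (hz t) (.of_forall hzK)
      (by rw [sub_self]; exact zero_mem_normalCone K _)]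
    exact hz t

/-- Solutions in `K` at constant distance from an interior equilibrium are recurrent. -/
theorem isRecurrentTrajectory_of_dist_const [FiniteDimensional ℝ E] (hf : Continuous f)
    (hKc : Convex ℝ K) (hd : DissipativeOn f K) (hfd : DifferentiableAt ℝ f e)
    (he : e ∈ interior K) (hfe : f e = 0) {z : ℝ → E} (hz : ∀ t, HasDerivAt z (f (z t)) t)
    (hzK : ∀ t, z t ∈ K) {c : ℝ} (hc : ∀ t, dist (z t) e = c) : IsRecurrentTrajectory f K z := by
  have htraj := isProjTrajectory_of_hasDerivAt hf hz hzK
  have horth : ∀ t, inner ℝ (f (z t)) (z t - e) = 0 := by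
    intro t
    have h1 := ((hz t).sub_const e).norm_sq
    have h2 : HasDerivAt (fun r => ‖z r - e‖ ^ 2) 0 t := by
      have : (fun r => ‖z r - e‖ ^ 2) = fun _ => c ^ 2 := by
        funext r; rw [← dist_eq_norm, hc]
      rw [this]
      exact hasDerivAt_const t _
    have h3 := h1.unique h2
    rw [real_inner_comm]
    linarith
  set L := fderiv ℝ f e with hLdef
  have hL : HasFDerivAt f L e := hfd.hasFDerivAt
  have hlin : ∀ t, f (z t) = L (z t - e) := fun t =>
    eq_fderiv_of_inner_eq_zero hf hKc hd hL he hfe (hzK t) (horth t)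
  -- The quadratic form of `L` is nonpositive and vanishes on `z s - e` and `z t - e`. Its values on
  -- their sum and difference add up to `0`, so both vanish.
  have hskew : ∀ s t, inner ℝ (f (z s) - f (z t)) (z s - z t) = 0 := by
    intro s t
    have h1 := inner_fderiv_nonpos hd hL he ((z s - e) + (z t - e))
    have h2 := inner_fderiv_nonpos hd hL he ((z s - e) - (z t - e))
    have h3 := horth s
    have h4 := horth t
    have e1 : z s - z t = (z s - e) - (z t - e) := by abel
    rw [hlin] at h3 h4
    rw [hlin, hlin, e1]
    simp only [map_add, map_sub, inner_add_left, inner_add_right, inner_sub_left,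
      inner_sub_right] at h1 h2 h3 h4 ⊢
    linarith
  have hshift : ∀ r s, 0 ≤ r → 0 ≤ s → ‖z (r + s) - z r‖ = ‖z s - z 0‖ := by
    intro r s _ _
    have h1 : ∀ t, HasDerivAt (fun t => ‖z (t + s) - z t‖ ^ 2) 0 t := by
      intro t
      have h2 := (((hz (t + s)).comp_add_const t s).fun_sub (hz t)).norm_sq
      rwa [real_inner_comm, hskew, mul_zero] at h2
    have h3 := is_const_of_deriv_eq_zero (fun t => (h1 t).differentiableAt)
      (fun t => (h1 t).deriv) r 0
    rw [zero_add] at h3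
    exact (pow_left_inj₀ (norm_nonneg _) (norm_nonneg _) two_ne_zero).1 h3
  have hbound : ∀ t, 0 ≤ t → ‖z t‖ ≤ c + ‖e‖ := by
    intro t _
    have h1 := norm_add_le (z t - e) e
    rw [sub_add_cancel, ← dist_eq_norm, hc] at h1
    exact h1
  refine ⟨htraj, fun ε hε T => ?_⟩
  obtain ⟨t, hT, ht, h, -⟩ := exists_simultaneous_return hbound hbound hshift hshift hε T
  exact ⟨t, hT, ht, h⟩

end Interior

section Main

variable {n m : ℕ} {φ : Pt n m → ℝ} {K : Set (Pt n m)}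

/-! ### The subgradient method -/

theorem isSubgradTrajectory_iff {z : ℝ → Pt n m} :
    IsSubgradTrajectory φ K z ↔ IsProjTrajectory (gradField φ) K z :=
  ⟨fun h => ⟨h.mem, h.absolutelyContinuous, h.hasDerivAt⟩,
    fun h => ⟨h.mem, h.absolutelyContinuous, h.hasDerivAt⟩⟩

theorem omegaLimitSet_eq_projOmega : omegaLimitSet φ K = projOmega (gradField φ) K := by
  ext p
  simp only [omegaLimitSet, projOmega, mem_ofPred_eq, isSubgradTrajectory_iff]

theorem subgradField_affineSubspace (V : AffineSubspace ℝ (Pt n m)) {z : Pt n m} (hz : z ∈ V) :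
    subgradField φ (V : Set (Pt n m)) z = V.direction.starProjection (gradField φ z) :=
  sub_proj_normalCone_affineSubspace V hz _

theorem saddleSpan_eq_top (hK : Convex ℝ K) {e : Pt n m} (he : IsRestrictedSaddle φ K e)
    (hint : e ∈ interior K) : saddleSpan φ K = ⊤ := by
  rw [saddleSpan, minimalFace_eq_of_mem_interior hK (fun z hz => hz.1.1) he hint]
  exact affineSpan_eq_top_of_nonempty_interior
    ⟨e, interior_mono (subset_convexHull ℝ K) hint⟩

theorem IsRestrictedSaddle.mono {C : Set (Pt n m)} (hKC : K ⊆ C) {e : Pt n m}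
    (he : IsRestrictedSaddle φ C e) (heK : e ∈ K) : IsRestrictedSaddle φ K e :=
  ⟨⟨heK, fun x hx => he.1.2.1 x (hKC hx), fun y hy => he.1.2.2 y (hKC hy)⟩,
    fun w hw => he.2 w (hKC hw)⟩

/-- A solution whose distance from an equilibrium of a larger set decreases and which is recurrent
from each of its points stays at constant distance from the equilibrium. -/
theorem dist_const_of_recurrent {E : Type*} [NormedAddCommGroup E] [InnerProductSpace ℝ E]
    {f : E → E} {K C : Set E} (hKC : K ⊆ C) (hd : DissipativeOn f C) {q : E}
    (hq : IsEquilibrium f C q) {z : ℝ → E} (hz : ∀ t, HasDerivAt z (f (z t)) t)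
    (hrec : ∀ s, IsRecurrentTrajectory f K fun t => z (t + s)) (t : ℝ) :
    dist (z t) q = dist (z 0) q := by
  have hzK : ∀ t, z t ∈ K := fun t => by simpa using (hrec t).mem 0 le_rfl
  have hanti : Antitone fun t => ‖z t - q‖ ^ 2 := by
    refine antitone_of_hasDerivAt_nonpos (fun t => ((hz t).sub_const q).norm_sq) fun t => ?_
    have h1 := hd _ (hKC (hzK t)) _ hq.1
    have h2 := hq.2 _ (hKC (hzK t))
    rw [inner_sub_left] at h1
    rw [real_inner_comm]
    simp only [Pi.zero_apply]
    linarith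
  have hanti' : ∀ s t, s ≤ t → ‖z t - q‖ ≤ ‖z s - q‖ := fun s t hst =>
    le_of_sq_le_sq (hanti hst) (norm_nonneg _)
  -- The equilibrium `q` may lie outside `K`, so it need not be a trajectory in `K`; instead, a
  -- decreasing distance that almost returns to its earlier value is constant.
  have key : ∀ s t, s ≤ t → ‖z t - q‖ = ‖z s - q‖ := by
    intro s t hst
    refine le_antisymm (hanti' s t hst) (le_of_forall_pos_le_add fun ε hε => ?_)
    obtain ⟨r, hr, -, h⟩ := (hrec s).recurrent ε hε (t - s)
    have h1 := hanti' t (r + s) (by linarith)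
    have h2 := norm_sub_norm_le (z s - q) (z (r + s) - q)
    rw [sub_sub_sub_cancel_right, norm_sub_rev (z s) (z (r + s))] at h2
    rw [zero_add] at h
    linarith
  rw [dist_eq_norm, dist_eq_norm]
  rcases le_total 0 t with h | h
  · exact key 0 t h
  · exact (key t 0 h).symm

end Main

end SubgradientFaces

/-! ### The subgradient flow on the `ω`-limit set -/

open SubgradientFaces in
theorem mainTheorem2 {n m : ℕ} (K C : Set (Pt n m)) (φ : Pt n m → ℝ)
    (hKclosed : IsClosed K) (hKconvex : Convex ℝ K)
    (hφ : ContDiff ℝ 2 φ)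
    (hKC : K ⊆ C) (hC : Convex ℝ C) (hCspan : HasProductSpan C) (hφC : ConcaveConvexOn C φ)
    (hsaddle : ∃ z, IsRestrictedSaddle φ K z) :
    Convex ℝ (omegaLimitSet φ K) ∧
    ∃ Ψ : Flow ℝ (omegaLimitSet φ K),
      -- `Ψ` is a flow of isometries
      (∀ t, Isometry (Ψ t)) ∧
      -- for `t ≥ 0` it is the subgradient method on `K` started in `Ω`
      (∀ p, IsSubgradTrajectory φ K (fun t => (Ψ t p : Pt n m))) ∧
      (∀ z, IsSubgradTrajectory φ K z → ∀ p : omegaLimitSet φ K, z 0 = p →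
        ∀ t, 0 ≤ t → z t = Ψ t p) ∧
      -- (i) its trajectories solve the subgradient method on the affine subspace `V`
      (∀ p t, (Ψ t p : Pt n m) ∈ saddleSpan φ K ∧
        HasDerivAt (fun s => (Ψ s p : Pt n m))
          (subgradField φ (saddleSpan φ K : Set (Pt n m)) (Ψ t p)) t) ∧
      -- (ii) the case of a saddle point in the interior of `K`
      ((∃ z ∈ interior K, IsRestrictedSaddle φ C z) →
        {z : ℝ → Pt n m | ∃ p, ∀ t, z t = Ψ t p} =
            {z | z ∈ constDistSolutions φ C ∧ ∀ t, z t ∈ K} ∧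
          omegaLimitSet φ K =
            {p | ∃ z ∈ constDistSolutions φ C, (∀ t, z t ∈ K) ∧ ∃ t, z t = p}) := by
  have hφd : Differentiable ℝ φ := hφ.differentiable (by norm_num)
  have hf1 := contDiff_gradField hφ
  have hf : Continuous (gradField φ) := hf1.continuous
  have hdC : DissipativeOn (gradField φ) C := dissipativeOn_gradField hφd hf hC hCspan hφC
  have hd : DissipativeOn (gradField φ) K := fun z hz w hw => hdC z (hKC hz) w (hKC hw)
  have hsad : {z | IsRestrictedSaddle φ K z} = {z | IsEquilibrium (gradField φ) K z} :=
    ext fun z => isRestrictedSaddle_iff_mem_normalCone hφd (hφC.mono hKC hKconvex)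
  obtain ⟨e, he⟩ := hsaddle
  have he' : IsEquilibrium (gradField φ) K e := ⟨he.1.1, he.2⟩
  simp only [isSubgradTrajectory_iff]
  rw [omegaLimitSet_eq_projOmega]
  obtain ⟨Ψ, hΨ, hΨrec⟩ := exists_flow_projOmega hf hKclosed hd he'
  have hadd : ∀ s t p, Ψ (s + t) p = Ψ s (Ψ t p) := Ψ.map_add
  have huniq : ∀ z, IsProjTrajectory (gradField φ) K z → ∀ p : projOmega (gradField φ) K,
      z 0 = p → ∀ t, 0 ≤ t → z t = Ψ t p := fun z hz p hp t ht =>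
    hz.eq_of_eq hd (hΨrec p).toIsProjTrajectory (by rw [hp, Ψ.map_zero_apply]) ht
  have hspan : ∀ p t, (Ψ t p : Pt n m) ∈ saddleSpan φ K := fun p t => by
    rw [saddleSpan, hsad]
    exact subset_affineSpan ℝ _
      (projOmega_subset_minimalFace hf hKclosed hKconvex hd he' (Ψ t p).2)
  have hderiv : ∀ p t, HasDerivAt (fun s => (Ψ s p : Pt n m))
      (subgradField φ (saddleSpan φ K : Set (Pt n m)) (Ψ t p)) t := by
    intro p t
    rw [subgradField_affineSubspace _ (hspan p t), saddleSpan, hsad]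
    -- Restarting one unit earlier places `t` at the positive time `1`, where the two-sided
    -- derivative is available.
    have h1 := (hΨrec (Ψ (t - 1) p)).hasDerivAt_starProjection hf hKclosed hKconvex hd he'
      (t := t + (1 - t)) (by linarith)
    have h2 := h1.comp_add_const t (1 - t)
    have h3 : ∀ s, Ψ (s + (1 - t)) (Ψ (t - 1) p) = Ψ s p := fun s => by
      rw [← hadd]; congr 1; ring
    simpa only [h3] using h2
  refine ⟨convex_projOmega hf hKclosed hKconvex hd he', Ψ, hΨ,
    fun p => (hΨrec p).toIsProjTrajectory, huniq, fun p t => ⟨hspan p t, hderiv p t⟩, ?_⟩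
  rintro ⟨q, hqint, hqC⟩
  have hq0 : gradField φ q = 0 := eq_zero_of_mem_normalCone_interior
    (interior_mono hKC hqint) hqC.2
  have htop := saddleSpan_eq_top hKconvex (hqC.mono hKC (interior_subset hqint)) hqint
  have hderiv' : ∀ p t, HasDerivAt (fun s => (Ψ s p : Pt n m)) (gradField φ (Ψ t p)) t := by
    intro p t
    have h1 := hderiv p t
    rw [subgradField_affineSubspace _ (hspan p t), htop, AffineSubspace.direction_top,
      Submodule.starProjection_top] at h1
    exact h1
  have hΨK : ∀ p t, (Ψ t p : Pt n m) ∈ K := fun p t => by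
    have := (hΨrec (Ψ t p)).mem 0 le_rfl
    rwa [Ψ.map_zero_apply] at this
  have hforward : ∀ p, (fun t => (Ψ t p : Pt n m)) ∈ constDistSolutions φ C := fun p =>
    ⟨hderiv' p, fun w hw => ⟨_, fun t => dist_const_of_recurrent hKC hdC ⟨hw.1.1, hw.2⟩
      (hderiv' p) (fun s => by simpa only [hadd] using hΨrec (Ψ s p)) t⟩⟩
  have hbackward : ∀ z ∈ constDistSolutions φ C, (∀ t, z t ∈ K) →
      ∃ p : projOmega (gradField φ) K, ∀ t, z t = Ψ t p := by
    intro z hz hzK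
    obtain ⟨c, hc⟩ := hz.2 q hqC
    have hsol : ∀ s t, HasDerivAt (fun t => z (t + s)) (gradField φ (z (t + s))) t := fun s t =>
      (hz.1 (t + s)).comp_add_const t s
    have hrec : ∀ s, IsRecurrentTrajectory (gradField φ) K fun t => z (t + s) := fun s =>
      isRecurrentTrajectory_of_dist_const hf hKconvex hd (hf1.differentiable (by norm_num) q)
        hqint hq0 (hsol s) (fun t => hzK _) (fun t => hc _)
    have hmem : ∀ s, z s ∈ projOmega (gradField φ) K := fun s => by
      simpa using (hrec s).mem_projOmega
    have hflow : ∀ s t, 0 ≤ t → z (t + s) = Ψ t ⟨z s, hmem s⟩ := fun s t ht =>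
      huniq _ (hrec s).toIsProjTrajectory ⟨z s, hmem s⟩ (by simp) t ht
    refine ⟨⟨z 0, hmem 0⟩, fun t => ?_⟩
    rcases le_total 0 t with ht | ht
    · simpa using hflow 0 t ht
    -- For negative `t`, flow forward from `z t` to `z 0` and invert.
    · have h1 : (⟨z 0, hmem 0⟩ : projOmega (gradField φ) K) = Ψ (-t) ⟨z t, hmem t⟩ :=
        Subtype.ext (by simpa using hflow t (-t) (neg_nonneg.2 ht))
      rw [h1, ← hadd, add_neg_cancel, Ψ.map_zero_apply]
  refine ⟨ext fun z => ⟨?_, fun hz => hbackward z hz.1 hz.2⟩, ext fun p => ⟨fun hp => ?_, ?_⟩⟩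
  · rintro ⟨p, hp⟩
    obtain rfl : z = fun t => (Ψ t p : Pt n m) := funext hp
    exact ⟨hforward p, hΨK p⟩
  · exact ⟨_, hforward ⟨p, hp⟩, hΨK ⟨p, hp⟩, 0, by rw [Ψ.map_zero_apply]⟩
  · rintro ⟨z, hz, hzK, t, rfl⟩
    obtain ⟨p, hp⟩ := hbackward z hz hzK
    rw [hp t]
    exact (Ψ t p).2
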